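/- Let $\mathfrak h$ be a separable complex Hilbert space, let $\mathcal F=\bigoplus_{n\ge 0}\bigwedge^n\mathfrak h$ be the fermion Fock space over $\mathfrak h$ with creation operators $c^*(f)$, $f\in\mathfrak h$, annihilation operators $c(f)=c^*(f)^*$ and number operator $\widehat{\mathbb N}$ (equal to $n$ on $\bigwedge^n\mathfrak h$), and let $\mathrm{Ex}$ be the exchange operator on $\mathfrak h\otimes\mathfrak h$, $\mathrm{Ex}(f\otimes g)=g\otimes f$. Let $N\in\mathbb N$, $\gamma\in\mathcal B(\mathfrak h)$ and $\Gamma\in\mathcal B(\mathfrak h\otimes\mathfrak h)$. Assume that $(\gamma,\Gamma)$ is $N$-representable: there is a positive trace class operator $\rho$ on $\mathcal F$ with $\mathrm{tr}_{\mathcal F}\{\rho\}=1$ and $\widehat{\mathbb N}\rho=N\rho$ such that, for all $f,g,f_1,f_2,g_1,g_2\in\mathfrak h$, $$\langle f\,|\,\gamma g\rangle=\mathrm{tr}_{\mathcal F}\{\rho\,c^*(g)c(f)\},\qquad \langle f_1\otimes f_2\,|\,\Gamma(g_1\otimes g_2)\rangle=\mathrm{tr}_{\mathcal F}\{\rho\,c^*(g_2)c^*(g_1)c(f_1)c(f_2)\}.$$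 Then: (admissibility) $\gamma$ is trace class with $0\le\gamma\le 1$ and $\mathrm{tr}\{\gamma\}=N$, and $\Gamma$ is trace class with $\mathrm{Ex}\,\Gamma=\Gamma\,\mathrm{Ex}=-\Gamma$; (G-Condition) $\mathrm{tr}\{(A^*\otimes A)(\Gamma+\mathrm{Ex}(\gamma\otimes 1))\}\ge|\mathrm{tr}\{A\gamma\}|^2$ for every bounded operator $A$ on $\mathfrak h$; (P-Condition) $\Gamma\ge 0$; (Q-Condition) $\Gamma+(1-\mathrm{Ex})(1\otimes 1-\gamma\otimes 1-1\otimes\gamma)\ge 0$. Here the trace on the left-hand side of the G-Condition, whose argument need not be trace class when $\dim\mathfrak h=\infty$, is the double series $\sum_{k,l}\langle\varphi_k\otimes\varphi_l\,|\,\cdot\,(\varphi_k\otimes\varphi_l)\rangle$, for any orthonormal basis $(\varphi_k)$ of $\mathfrak h$, summed over one index and then over the other; it is part of the claim that both iterated series converge and that their common value is real and independent of the basis. -/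

import Mathlib

open scoped TensorProduct InnerProductSpace

universe u

noncomputable section

namespace FermionFock

/-! ### Trace class operators and traces on a complex Hilbert space -/

section Trace

variable {E : Type u} [NormedAddCommGroup E] [InnerProductSpace ℂ E] [CompleteSpace E]

/-- `T` is trace class: `∑ᵢ ⟨eᵢ, |T| eᵢ⟩ < ∞` for orthonormal bases `(eᵢ)`, where `|T| = √(T* T)`.
(As `|T| ≥ 0`, finiteness for one orthonormal basis is the same as finiteness for all of them.) -/
def IsTraceClass (T : E →L[ℂ] E) : Prop :=
  ∀ (ι : Type u) (e : HilbertBasis ι ℂ E), Summable fun i => (⟪e i, CFC.abs T (e i)⟫_ℂ).re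

/-- `T` is trace class and `tr T = z`, i.e. `∑ᵢ ⟨eᵢ, T eᵢ⟩ = z` for the orthonormal bases `(eᵢ)`. -/
def HasTrace (T : E →L[ℂ] E) (z : ℂ) : Prop :=
  IsTraceClass T ∧ ∀ (ι : Type u) (e : HilbertBasis ι ℂ E), HasSum (fun i => ⟪e i, T (e i)⟫_ℂ) z

/-- A density matrix: a positive trace class operator of unit trace. -/
def IsDensityMatrix (ρ : E →L[ℂ] E) : Prop :=
  0 ≤ ρ ∧ HasTrace ρ 1

end Trace

variable {H : Type u} [NormedAddCommGroup H] [InnerProductSpace ℂ H]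

/-! ### The inner product on the exterior algebra

The algebraic fermion Fock space over `H` is the exterior algebra `⋀ H = ⨁ₙ ⋀ⁿ H`. It carries the
inner product for which left multiplication by `f` and contraction with `⟨f, ·⟩` are adjoint to each
other and `1` is a unit vector; on decomposable vectors it is
`⟨f₁ ∧ ⋯ ∧ fₘ, g₁ ∧ ⋯ ∧ gₙ⟩ = δₘₙ det ⟨fᵢ, gⱼ⟩`. -/

section Algebraic

/-- The contraction `f ⌟ ·` of the exterior algebra with the functional `⟨f, ·⟩`: the antiderivation
with `f ⌟ 1 = 0` and `f ⌟ (g ∧ x) = ⟨f, g⟩ x - g ∧ (f ⌟ x)`. -/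
def contract (f : H) : Module.End ℂ (ExteriorAlgebra ℂ H) :=
  CliffordAlgebra.contractLeft (Q := (0 : QuadraticForm ℂ H)) (innerSL ℂ f).toLinearMap

lemma contract_one (f : H) : contract f (1 : ExteriorAlgebra ℂ H) = 0 :=
  CliffordAlgebra.contractLeft_one ..

lemma contract_algebraMap (f : H) (r : ℂ) :
    contract f (algebraMap ℂ (ExteriorAlgebra ℂ H) r) = 0 :=
  CliffordAlgebra.contractLeft_algebraMap ..

lemma contract_ι_mul (f g : H) (x : ExteriorAlgebra ℂ H) :
    contract f (ExteriorAlgebra.ι ℂ g * x)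
      = ⟪f, g⟫_ℂ • x - ExteriorAlgebra.ι ℂ g * contract f x := by
  simpa [contract] using CliffordAlgebra.contractLeft_ι_mul
    (Q := (0 : QuadraticForm ℂ H)) (d := (innerSL ℂ f).toLinearMap) g x

lemma contract_contract (f : H) (x : ExteriorAlgebra ℂ H) : contract f (contract f x) = 0 :=
  CliffordAlgebra.contractLeft_contractLeft ..

lemma contract_add (f g : H) : contract (f + g) = contract f + contract g := by
  simp [contract]

lemma contract_smul (r : ℂ) (f : H) :
    contract (r • f) = (starRingEnd ℂ r) • contract f := by
  have h : (innerSL ℂ (r • f)).toLinearMap = (starRingEnd ℂ r) • (innerSL ℂ f).toLinearMap := by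
    ext x; simp
  rw [contract, h, map_smul]; rfl

variable (H) in
/-- The opposite of the algebra of endomorphisms of the exterior algebra, on which `r : ℂ` acts
as multiplication by the complex conjugate of `r`. -/
def ConjEnd : Type u := (Module.End ℂ (ExteriorAlgebra ℂ H))ᵐᵒᵖ

instance : Ring (ConjEnd H) :=
  inferInstanceAs (Ring (Module.End ℂ (ExteriorAlgebra ℂ H))ᵐᵒᵖ)

/-- The endomorphism underlying an element of `ConjEnd H`. -/
def ConjEnd.toEnd (a : ConjEnd H) : Module.End ℂ (ExteriorAlgebra ℂ H) :=
  MulOpposite.unop a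

/-- An endomorphism as an element of `ConjEnd H`. -/
def ConjEnd.ofEnd (a : Module.End ℂ (ExteriorAlgebra ℂ H)) : ConjEnd H :=
  MulOpposite.op a

lemma ConjEnd.toEnd_injective : Function.Injective (ConjEnd.toEnd (H := H)) :=
  MulOpposite.unop_injective

lemma ConjEnd.toEnd_mul (a b : ConjEnd H) : (a * b).toEnd = b.toEnd * a.toEnd := rfl

variable (H) in
/-- The twisted scalars of `ConjEnd H`. -/
def conjScalar : ℂ →+* ConjEnd H where
  toFun r := ConjEnd.ofEnd ((starRingEnd ℂ r) • (1 : Module.End ℂ (ExteriorAlgebra ℂ H)))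
  map_one' := ConjEnd.toEnd_injective (by
    change (starRingEnd ℂ 1) • (1 : Module.End ℂ (ExteriorAlgebra ℂ H)) = 1
    rw [map_one, one_smul])
  map_mul' r t := ConjEnd.toEnd_injective (by
    rw [ConjEnd.toEnd_mul]
    change (starRingEnd ℂ (r * t)) • (1 : Module.End ℂ (ExteriorAlgebra ℂ H))
      = ((starRingEnd ℂ t) • 1) * ((starRingEnd ℂ r) • 1)
    rw [map_mul, smul_mul_smul_comm, mul_one, mul_comm])
  map_zero' := ConjEnd.toEnd_injective (by
    change (starRingEnd ℂ 0) • (1 : Module.End ℂ (ExteriorAlgebra ℂ H)) = 0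
    rw [map_zero, zero_smul])
  map_add' r t := ConjEnd.toEnd_injective (by
    change (starRingEnd ℂ (r + t)) • (1 : Module.End ℂ (ExteriorAlgebra ℂ H))
      = (starRingEnd ℂ r) • 1 + (starRingEnd ℂ t) • 1
    rw [map_add, add_smul])

lemma conjScalar_mul (r : ℂ) (a : ConjEnd H) :
    (conjScalar H r * a).toEnd = (starRingEnd ℂ r) • a.toEnd := by
  rw [ConjEnd.toEnd_mul]
  change a.toEnd * ((starRingEnd ℂ r) • 1) = _
  rw [mul_smul_comm, mul_one]

lemma mul_conjScalar (r : ℂ) (a : ConjEnd H) :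
    (a * conjScalar H r).toEnd = (starRingEnd ℂ r) • a.toEnd := by
  rw [ConjEnd.toEnd_mul]
  change ((starRingEnd ℂ r) • 1) * a.toEnd = _
  rw [smul_mul_assoc, one_mul]

instance : Algebra ℂ (ConjEnd H) :=
  RingHom.toAlgebra' (conjScalar H) fun r a =>
    ConjEnd.toEnd_injective (by rw [conjScalar_mul, mul_conjScalar])

lemma ConjEnd.toEnd_smul (r : ℂ) (a : ConjEnd H) :
    (r • a).toEnd = (starRingEnd ℂ r) • a.toEnd := by
  rw [Algebra.smul_def]
  exact conjScalar_mul r a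

variable (H) in
/-- The antilinear algebra antihomomorphism `f₁ ∧ ⋯ ∧ fₙ ↦ (fₙ ⌟ ·) ∘ ⋯ ∘ (f₁ ⌟ ·)`. -/
def contractAlg : ExteriorAlgebra ℂ H →ₐ[ℂ] ConjEnd H :=
  ExteriorAlgebra.lift ℂ
    ⟨{ toFun := fun f => ConjEnd.ofEnd (contract f)
       map_add' := fun f g => by rw [contract_add]; rfl
       map_smul' := fun r f => ConjEnd.toEnd_injective (by
        rw [ConjEnd.toEnd_smul]; exact contract_smul r f) },
     fun f => ConjEnd.toEnd_injective (LinearMap.ext fun x => contract_contract f x)⟩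

/-- The inner product of the exterior algebra: for `x = f₁ ∧ ⋯ ∧ fₙ` it is the component of
`fₙ ⌟ (⋯ (f₁ ⌟ y))` in degree zero. -/
def form (x y : ExteriorAlgebra ℂ H) : ℂ :=
  ExteriorAlgebra.algebraMapInv ((contractAlg H x).toEnd y)

lemma form_add_left (x y z : ExteriorAlgebra ℂ H) : form (x + y) z = form x z + form y z := by
  unfold form
  rw [map_add, ← map_add ExteriorAlgebra.algebraMapInv]
  rfl

lemma form_smul_left (r : ℂ) (x y : ExteriorAlgebra ℂ H) :
    form (r • x) y = starRingEnd ℂ r * form x y := by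
  simp [form, ConjEnd.toEnd_smul]

lemma form_add_right (x y z : ExteriorAlgebra ℂ H) : form x (y + z) = form x y + form x z := by
  simp [form]

lemma form_smul_right (r : ℂ) (x y : ExteriorAlgebra ℂ H) : form x (r • y) = r * form x y := by
  simp [form]

lemma form_zero_left (y : ExteriorAlgebra ℂ H) : form 0 y = 0 := by
  simpa using form_smul_left 0 0 y

lemma form_sub_left (x y z : ExteriorAlgebra ℂ H) : form (x - y) z = form x z - form y z := by
  have := form_add_left (x - y) y z
  rw [sub_add_cancel] at this
  rw [this]; ring

lemma form_sub_right (x y z : ExteriorAlgebra ℂ H) : form x (y - z) = form x y - form x z := by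
  simp [form]

lemma form_one_left (y : ExteriorAlgebra ℂ H) : form 1 y = ExteriorAlgebra.algebraMapInv y := by
  rw [form, map_one]; rfl

lemma form_ι_mul_left (f : H) (x y : ExteriorAlgebra ℂ H) :
    form (ExteriorAlgebra.ι ℂ f * x) y = form x (contract f y) := by
  rw [form, map_mul, contractAlg, ExteriorAlgebra.lift_ι_apply]; rfl

lemma algebraMapInv_ι_mul (f : H) (x : ExteriorAlgebra ℂ H) :
    ExteriorAlgebra.algebraMapInv (ExteriorAlgebra.ι ℂ f * x) = 0 := by
  simp [ExteriorAlgebra.algebraMapInv]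

lemma form_ι_mul_right (f : H) (x y : ExteriorAlgebra ℂ H) :
    form x (ExteriorAlgebra.ι ℂ f * y) = form (contract f x) y := by
  induction x using CliffordAlgebra.left_induction generalizing y with
  | algebraMap r =>
    erw [contract_algebraMap]
    rw [Algebra.algebraMap_eq_smul_one, form_smul_left, form_one_left, algebraMapInv_ι_mul,
      mul_zero, form_zero_left]
  | add x₁ x₂ h₁ h₂ => rw [form_add_left, h₁, h₂, map_add, form_add_left]
  | ι_mul x g h =>
    change form (ExteriorAlgebra.ι ℂ g * x) _ = form (contract f (ExteriorAlgebra.ι ℂ g * x)) y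
    rw [form_ι_mul_left, contract_ι_mul, contract_ι_mul, form_sub_right, form_smul_right, h,
      form_sub_left, form_smul_left, form_ι_mul_left, inner_conj_symm]

lemma form_one_right (x : ExteriorAlgebra ℂ H) :
    form x 1 = starRingEnd ℂ (ExteriorAlgebra.algebraMapInv x) := by
  induction x using CliffordAlgebra.left_induction with
  | algebraMap r =>
    rw [Algebra.algebraMap_eq_smul_one, form_smul_left, form_one_left]; simp
  | add x₁ x₂ h₁ h₂ => rw [form_add_left, h₁, h₂, map_add, map_add]
  | ι_mul x g h =>
    change form (ExteriorAlgebra.ι ℂ g * x) 1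
      = starRingEnd ℂ (ExteriorAlgebra.algebraMapInv (ExteriorAlgebra.ι ℂ g * x))
    rw [algebraMapInv_ι_mul, form_ι_mul_left, contract_one]; simp [form]

lemma form_conj_symm (x y : ExteriorAlgebra ℂ H) : starRingEnd ℂ (form y x) = form x y := by
  induction x using CliffordAlgebra.left_induction generalizing y with
  | algebraMap r =>
    rw [Algebra.algebraMap_eq_smul_one, form_smul_left, form_smul_right, form_one_left,
      form_one_right]
    simp
  | add x₁ x₂ h₁ h₂ => rw [form_add_left, form_add_right, map_add, h₁, h₂]
  | ι_mul x g h =>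
    change starRingEnd ℂ (form y (ExteriorAlgebra.ι ℂ g * x)) = form (ExteriorAlgebra.ι ℂ g * x) y
    rw [form_ι_mul_left, form_ι_mul_right, h]

/-- A submodule that contains `1` and is stable under left multiplication by the vectors of `s`
contains the subalgebra generated by `s`. -/
lemma adjoin_le_of_stable (s : Set H) (M : Submodule ℂ (ExteriorAlgebra ℂ H)) (h1 : 1 ∈ M)
    (hM : ∀ f ∈ s, ∀ x ∈ M, ExteriorAlgebra.ι ℂ f * x ∈ M) {x : ExteriorAlgebra ℂ H}
    (hx : x ∈ Algebra.adjoin ℂ (ExteriorAlgebra.ι ℂ '' s)) : x ∈ M := by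
  have key : ∀ m ∈ M, x * m ∈ M := by
    induction hx using Algebra.adjoin_induction with
    | mem x hx => obtain ⟨f, hf, rfl⟩ := hx; exact fun m hm => hM f hf m hm
    | algebraMap r => intro m hm; rw [← Algebra.smul_def]; exact M.smul_mem r hm
    | add x y _ _ hx hy => intro m hm; rw [add_mul]; exact M.add_mem (hx m hm) (hy m hm)
    | mul x y _ _ hx hy => intro m hm; rw [mul_assoc]; exact hx _ (hy m hm)
  simpa using key 1 h1

lemma ι_mul_ι_mul (f g : H) (x : ExteriorAlgebra ℂ H) :
    ExteriorAlgebra.ι ℂ f * (ExteriorAlgebra.ι ℂ g * x)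
      = -(ExteriorAlgebra.ι ℂ g * (ExteriorAlgebra.ι ℂ f * x)) := by
  have h := ExteriorAlgebra.ι_add_mul_swap (R := ℂ) f g
  rw [← mul_assoc, ← mul_assoc, eq_neg_of_add_eq_zero_left h, neg_mul]

lemma form_self_of_orthonormal (s : Finset H) :
    (Orthonormal ℂ ((↑) : s → H)) →
    ∀ x ∈ Algebra.adjoin ℂ (ExteriorAlgebra.ι ℂ '' (s : Set H)),
      0 ≤ (form x x).re ∧ (form x x = 0 → x = 0) := by
  classical
  induction s using Finset.induction with
  | empty =>
    intro _ x hx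
    simp only [Finset.coe_empty, Set.image_empty, Algebra.adjoin_empty, Algebra.mem_bot,
      Set.mem_range] at hx
    obtain ⟨r, rfl⟩ := hx
    have : form (algebraMap ℂ (ExteriorAlgebra ℂ H) r) (algebraMap ℂ _ r) = (‖r‖ ^ 2 : ℝ) := by
      rw [Algebra.algebraMap_eq_smul_one, form_smul_left, form_smul_right, form_one_left]
      simp [RCLike.conj_mul]
    rw [this]
    refine ⟨by rw [Complex.ofReal_re]; positivity, fun h => ?_⟩
    have h2 : r = 0 := by simpa using h
    simp [h2]
  | insert e s he ih =>
    intro hon x hx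
    have hs : Orthonormal ℂ ((↑) : s → H) := by
      have := hon.comp (fun i : s => (⟨i.1, Finset.mem_insert_of_mem i.2⟩ : ↥(insert e s)))
        (fun i j hij => Subtype.ext (by simpa using hij))
      exact this
    have hee : ⟪e, e⟫_ℂ = 1 := by
      have := hon.1 ⟨e, Finset.mem_insert_self e s⟩
      rw [inner_self_eq_norm_sq_to_K]
      simp only at this
      simp [this]
    have hes : ∀ f ∈ s, ⟪e, f⟫_ℂ = 0 := fun f hf =>
      hon.2 (i := ⟨e, Finset.mem_insert_self e s⟩) (j := ⟨f, Finset.mem_insert_of_mem hf⟩)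
        (fun h => by have h2 : e = f := congrArg Subtype.val h; subst h2; exact he hf)
    set B := Algebra.adjoin ℂ (ExteriorAlgebra.ι ℂ '' (s : Set H)) with hB
    have hker : ∀ b ∈ B, contract e b = 0 := fun b hb => by
      have := adjoin_le_of_stable (s : Set H) (LinearMap.ker (contract e))
        (by simpa using contract_one e)
        (fun f hf x hx => by
          rw [LinearMap.mem_ker] at hx ⊢
          rw [contract_ι_mul, hes f hf, hx]; simp) hb
      simpa using this
    have hdec : ∃ a ∈ B, ∃ b ∈ B, x = a + ExteriorAlgebra.ι ℂ e * b := by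
      let M : Submodule ℂ (ExteriorAlgebra ℂ H) :=
        Subalgebra.toSubmodule B ⊔
          (Subalgebra.toSubmodule B).map (LinearMap.mulLeft ℂ (ExteriorAlgebra.ι ℂ e))
      have hmem : x ∈ M := by
        refine adjoin_le_of_stable _ M (Submodule.mem_sup_left B.one_mem) ?_ hx
        intro f hf y hy
        obtain ⟨a, ha, c, hc, rfl⟩ := Submodule.mem_sup.1 hy
        obtain ⟨b, hb, rfl⟩ := hc
        rw [Finset.coe_insert] at hf
        rw [mul_add]
        refine M.add_mem ?_ ?_
        · rcases hf with rfl | hf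
          · exact Submodule.mem_sup_right ⟨a, ha, rfl⟩
          · exact Submodule.mem_sup_left (B.mul_mem (Algebra.subset_adjoin ⟨f, hf, rfl⟩) ha)
        · rw [LinearMap.mulLeft_apply]
          rcases hf with rfl | hf
          · rw [← mul_assoc, ExteriorAlgebra.ι_sq_zero, zero_mul]; exact M.zero_mem
          · rw [ι_mul_ι_mul]
            exact M.neg_mem (Submodule.mem_sup_right
              ⟨_, B.mul_mem (Algebra.subset_adjoin ⟨f, hf, rfl⟩) hb, rfl⟩)
      obtain ⟨a, ha, c, hc, rfl⟩ := Submodule.mem_sup.1 hmem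
      obtain ⟨b, hb, rfl⟩ := hc
      exact ⟨a, ha, b, hb, rfl⟩
    obtain ⟨a, ha, b, hb, rfl⟩ := hdec
    have hval : form (a + ExteriorAlgebra.ι ℂ e * b) (a + ExteriorAlgebra.ι ℂ e * b)
        = form a a + form b b := by
      rw [form_add_left, form_add_right, form_add_right, form_ι_mul_left, form_ι_mul_left,
        form_ι_mul_right, contract_ι_mul, hker a ha, hker b hb, hee, form_zero_left]
      simp [form]
    obtain ⟨ha1, ha2⟩ := ih hs a ha
    obtain ⟨hb1, hb2⟩ := ih hs b hb
    rw [hval]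
    refine ⟨by rw [Complex.add_re]; exact add_nonneg ha1 hb1, fun h => ?_⟩
    have him : ∀ z : ExteriorAlgebra ℂ H, (form z z).im = 0 := fun z =>
      Complex.conj_eq_iff_im.1 (form_conj_symm z z)
    have hre := congrArg Complex.re h
    rw [Complex.add_re, Complex.zero_re] at hre
    have ha0 : form a a = 0 := Complex.ext (by rw [Complex.zero_re]; linarith) (him a)
    have hb0 : form b b = 0 := Complex.ext (by rw [Complex.zero_re]; linarith) (him b)
    rw [ha2 ha0, hb2 hb0]; simp

lemma exists_orthonormal_mem_adjoin (x : ExteriorAlgebra ℂ H) :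
    ∃ s : Finset H, Orthonormal ℂ ((↑) : s → H) ∧
      x ∈ Algebra.adjoin ℂ (ExteriorAlgebra.ι ℂ '' (s : Set H)) := by
  classical
  have h1 : ∃ t : Finset H, x ∈ Algebra.adjoin ℂ (ExteriorAlgebra.ι ℂ '' (t : Set H)) := by
    induction x using ExteriorAlgebra.induction with
    | algebraMap r => exact ⟨∅, Subalgebra.algebraMap_mem _ r⟩
    | ι f => exact ⟨{f}, Algebra.subset_adjoin ⟨f, by simp, rfl⟩⟩
    | mul a b ha hb =>
      obtain ⟨s, hs⟩ := ha
      obtain ⟨t, ht⟩ := hb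
      exact ⟨s ∪ t, Subalgebra.mul_mem _
        (Algebra.adjoin_mono (Set.image_mono (by simp)) hs)
        (Algebra.adjoin_mono (Set.image_mono (by simp)) ht)⟩
    | add a b ha hb =>
      obtain ⟨s, hs⟩ := ha
      obtain ⟨t, ht⟩ := hb
      exact ⟨s ∪ t, Subalgebra.add_mem _
        (Algebra.adjoin_mono (Set.image_mono (by simp)) hs)
        (Algebra.adjoin_mono (Set.image_mono (by simp)) ht)⟩
  obtain ⟨t, ht⟩ := h1
  let V := Submodule.span ℂ (t : Set H)
  let b := stdOrthonormalBasis ℂ V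
  let v : Fin (Module.finrank ℂ V) → H := fun i => (b i : H)
  have hv : Orthonormal ℂ v := b.orthonormal.comp_linearIsometry V.subtypeₗᵢ
  refine ⟨Finset.univ.image v, ?_, ?_⟩
  · have hr := hv.toSubtypeRange
    have he : ((Finset.univ.image v : Finset H) : Set H) = Set.range v := by simp
    exact hr.comp (fun i : ↥(Finset.univ.image v) =>
      (⟨i.1, he ▸ (Finset.mem_coe.2 i.2)⟩ : ↥(Set.range v)))
      (fun i j hij => Subtype.ext (congrArg (fun w : Set.range v => (w : H)) hij))
  · refine Algebra.adjoin_le ?_ ht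
    rintro _ ⟨f, hf, rfl⟩
    have hf' : (⟨f, Submodule.subset_span hf⟩ : V) = ∑ i, _ • b i := (b.sum_repr _).symm
    have hf2 := congrArg (fun w : V => ExteriorAlgebra.ι ℂ (w : H)) hf'
    simp only [Submodule.coe_sum, Submodule.coe_smul, map_sum, map_smul] at hf2
    rw [hf2]
    exact Subalgebra.sum_mem _ fun i _ => Subalgebra.smul_mem _
      (Algebra.subset_adjoin (Set.mem_image_of_mem _ (by simp [v]))) _

/-- The inner product of the exterior algebra is a positive definite sesquilinear form. -/
instance formCore : InnerProductSpace.Core ℂ (ExteriorAlgebra ℂ H) where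
  inner := form
  conj_inner_symm := form_conj_symm
  re_inner_nonneg x := by
    obtain ⟨s, hs, hx⟩ := exists_orthonormal_mem_adjoin x
    exact (form_self_of_orthonormal s hs x hx).1
  add_left := form_add_left
  smul_left x y r := form_smul_left r x y
  definite x h := by
    obtain ⟨s, hs, hx⟩ := exists_orthonormal_mem_adjoin x
    exact (form_self_of_orthonormal s hs x hx).2 h

instance : NormedAddCommGroup (ExteriorAlgebra ℂ H) :=
  InnerProductSpace.Core.toNormedAddCommGroup (𝕜 := ℂ)

instance : InnerProductSpace ℂ (ExteriorAlgebra ℂ H) :=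
  InnerProductSpace.ofCore _

lemma inner_eq_form (x y : ExteriorAlgebra ℂ H) : ⟪x, y⟫_ℂ = form x y := rfl

/-- `‖f ∧ x‖² + ‖f ⌟ x‖² = ‖f‖² ‖x‖²`, hence `‖f ∧ x‖ ≤ ‖f‖ ‖x‖`. -/
lemma norm_ι_mul_le (f : H) (x : ExteriorAlgebra ℂ H) :
    ‖ExteriorAlgebra.ι ℂ f * x‖ ≤ ‖f‖ * ‖x‖ := by
  have h : ⟪ExteriorAlgebra.ι ℂ f * x, ExteriorAlgebra.ι ℂ f * x⟫_ℂ
      = ⟪f, f⟫_ℂ * ⟪x, x⟫_ℂ - ⟪contract f x, contract f x⟫_ℂ := by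
    simp only [inner_eq_form]
    rw [form_ι_mul_left, contract_ι_mul, form_sub_right, form_smul_right, form_ι_mul_right]
  simp only [inner_self_eq_norm_sq_to_K] at h
  have h' : ‖ExteriorAlgebra.ι ℂ f * x‖ ^ 2 = ‖f‖ ^ 2 * ‖x‖ ^ 2 - ‖contract f x‖ ^ 2 := by
    exact_mod_cast h
  refine (sq_le_sq₀ (norm_nonneg _) (by positivity)).1 ?_
  rw [mul_pow, h']; nlinarith [sq_nonneg ‖contract f x‖]

/-- Left multiplication `x ↦ f ∧ x` on the exterior algebra, a bounded operator. -/
def wedgeL (f : H) : ExteriorAlgebra ℂ H →L[ℂ] ExteriorAlgebra ℂ H :=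
  (LinearMap.mulLeft ℂ (ExteriorAlgebra.ι ℂ f)).mkContinuous ‖f‖ (norm_ι_mul_le f)

end Algebraic

/-! ### Fock space, creation and annihilation operators, number operator -/

variable (H) in
/-- The fermion Fock space `ℱ[H]`: the Hilbert space completion of `⨁ₙ ⋀ⁿ H`. -/
abbrev Fock : Type u := UniformSpace.Completion (ExteriorAlgebra ℂ H)

variable (H) in
/-- The vacuum vector `Ω`. -/
def vacuum : Fock H := ((1 : ExteriorAlgebra ℂ H) : Fock H)

/-- The creation operator `c*(f)`: the bounded extension of `x ↦ f ∧ x`. -/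
def creation (f : H) : Fock H →L[ℂ] Fock H := (wedgeL f).completion

/-- The annihilation operator `c(f)`, the adjoint of `c*(f)`. -/
def annihilation (f : H) : Fock H →L[ℂ] Fock H := ContinuousLinearMap.adjoint (creation f)

variable (H) in
/-- The `n`-particle sector `ℱ⁽ⁿ⁾[H]`: the closure of `⋀ⁿ H` in the Fock space. -/
def sector (n : ℕ) : Submodule ℂ (Fock H) :=
  ((⋀[ℂ]^n H).map
    (UniformSpace.Completion.toComplL (𝕜 := ℂ) (E := ExteriorAlgebra ℂ H)).toLinearMap).topologicalClosure

instance (n : ℕ) : CompleteSpace (sector H n) :=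
  (Submodule.isClosed_topologicalClosure _).completeSpace_coe

variable (H) in
/-- The particle number operator `N̂ = ∑ₙ n Pₙ`, where `Pₙ` is the orthogonal projection onto the
`n`-particle sector, with its maximal domain (all `ψ` for which the series converges; since the
sectors are mutually orthogonal, this means `∑ₙ n² ‖Pₙ ψ‖² < ∞`). -/
def numberOperator : Fock H →ₗ.[ℂ] Fock H where
  domain :=
    { carrier := {ψ | Summable fun n : ℕ => (n : ℂ) • (sector H n).starProjection ψ}
      add_mem' := fun {a b} ha hb => by
        have h := Summable.add ha hb
        simp only [← smul_add, ← map_add] at h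
        exact h
      zero_mem' := by simp [summable_zero]
      smul_mem' := fun r a ha => by
        have h := Summable.const_smul r ha
        simp only [smul_comm r] at h
        simp only [← map_smul (Submodule.starProjection _) r] at h
        exact h }
  toFun :=
    { toFun := fun ψ => ∑' n : ℕ, (n : ℂ) • (sector H n).starProjection (ψ : Fock H)
      map_add' := fun a b => by
        simp only [Submodule.coe_add, map_add, smul_add]
        exact Summable.tsum_add a.2 b.2
      map_smul' := fun r a => by
        simp only [Submodule.coe_smul, map_smul, smul_comm _ r, RingHom.id_apply]
        exact Summable.tsum_const_smul r a.2 }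

/-! ### The two-particle space -/

variable (H) in
/-- The Hilbert space tensor product `H ⊗ H`. -/
abbrev TwoParticle : Type u := UniformSpace.Completion (H ⊗[ℂ] H)

/-- The elementary tensor `f ⊗ g` in the Hilbert space tensor product. -/
def tmul (f g : H) : TwoParticle H := ((f ⊗ₜ[ℂ] g : H ⊗[ℂ] H) : TwoParticle H)

/-- The bounded operator `A ⊗ B`, with `(A ⊗ B) (f ⊗ g) = A f ⊗ B g`. -/
def opTensor (A B : H →L[ℂ] H) : TwoParticle H →L[ℂ] TwoParticle H :=
  (TensorProduct.mapL A B).completion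

variable (H) in
/-- The exchange operator, `Ex (f ⊗ g) = g ⊗ f`. -/
def exchange : TwoParticle H →L[ℂ] TwoParticle H :=
  (TensorProduct.commIsometry ℂ H H).toContinuousLinearEquiv.toContinuousLinearMap.completion

/-- `tr T = z` on `H ⊗ H`, where the trace of the bounded operator `T` is read as the double series
`∑ₖₗ ⟨eₖ ⊗ eₗ, T (eₖ ⊗ eₗ)⟩`, summed in either order, for the orthonormal bases `(eₖ)` of `H`.
For trace class `T` this is the usual trace. The wider reading is needed for `(A* ⊗ A) Ex (γ ⊗ 1)`,
which for infinite-dimensional `H` and general bounded `A` is not trace class. -/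
def HasTensorTrace (T : TwoParticle H →L[ℂ] TwoParticle H) (z : ℂ) : Prop :=
  ∀ (ι : Type u) (e : HilbertBasis ι ℂ H),
    (∃ r : ι → ℂ, (∀ k, HasSum (fun l => ⟪tmul (e k) (e l), T (tmul (e k) (e l))⟫_ℂ) (r k)) ∧
      HasSum r z) ∧
    (∃ c : ι → ℂ, (∀ l, HasSum (fun k => ⟪tmul (e k) (e l), T (tmul (e k) (e l))⟫_ℂ) (c l)) ∧
      HasSum c z)

/-! ### Reduced density matrices and representability -/

/-- `γ` is the one-particle density matrix of `ρ`: `⟨f, γ g⟩ = tr (ρ c*(g) c(f))`. -/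
def IsOnePDM (ρ : Fock H →L[ℂ] Fock H) (γ : H →L[ℂ] H) : Prop :=
  ∀ f g : H, HasTrace (ρ ∘L creation g ∘L annihilation f) ⟪f, γ g⟫_ℂ

/-- `Γ` is the two-particle density matrix of `ρ`:
`⟨f₁ ⊗ f₂, Γ (g₁ ⊗ g₂)⟩ = tr (ρ c*(g₂) c*(g₁) c(f₁) c(f₂))`. -/
def IsTwoPDM (ρ : Fock H →L[ℂ] Fock H) (Γ : TwoParticle H →L[ℂ] TwoParticle H) : Prop :=
  ∀ f₁ f₂ g₁ g₂ : H,
    HasTrace (ρ ∘L creation g₂ ∘L creation g₁ ∘L annihilation f₁ ∘L annihilation f₂)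
      ⟪tmul f₁ f₂, Γ (tmul g₁ g₂)⟫_ℂ

/-- `N̂ ρ = N ρ`: the range of `ρ` lies in the domain of `N̂`, and `N̂ (ρ ψ) = N ρ ψ` for all `ψ`. -/
def HasParticleNumber (N : ℕ) (ρ : Fock H →L[ℂ] Fock H) : Prop :=
  ∀ ψ : Fock H, ∃ h : ρ ψ ∈ (numberOperator H).domain,
    numberOperator H ⟨ρ ψ, h⟩ = (N : ℂ) • ρ ψ

/-- `(γ, Γ)` is `N`-representable: it is the pair of reduced density matrices of a density matrix
`ρ` on the Fock space with `N̂ ρ = N ρ`. -/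
def IsNRepresentable (N : ℕ) (γ : H →L[ℂ] H) (Γ : TwoParticle H →L[ℂ] TwoParticle H) : Prop :=
  ∃ ρ : Fock H →L[ℂ] Fock H,
    IsDensityMatrix ρ ∧ HasParticleNumber N ρ ∧ IsOnePDM ρ γ ∧ IsTwoPDM ρ Γ

/-- Admissibility: `γ` is trace class with `0 ≤ γ ≤ 1` and `tr γ = N`, `Γ` is trace class, and
`Ex Γ = Γ Ex = -Γ`. -/
structure IsAdmissible [CompleteSpace H] (N : ℕ) (γ : H →L[ℂ] H)
    (Γ : TwoParticle H →L[ℂ] TwoParticle H) : Prop where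
  nonneg : 0 ≤ γ
  le_one : γ ≤ 1
  trace_eq : HasTrace γ (N : ℂ)
  traceClass : IsTraceClass Γ
  exchange_left : exchange H ∘L Γ = -Γ
  exchange_right : Γ ∘L exchange H = -Γ

/-- The P-Condition `Γ ≥ 0`. -/
def PCondition (Γ : TwoParticle H →L[ℂ] TwoParticle H) : Prop := 0 ≤ Γ

/-- The G-Condition: `tr ((A* ⊗ A) (Γ + Ex (γ ⊗ 1))) ≥ |tr (A γ)|²` for every bounded `A`. Both
traces are asserted to exist, and the first one to be real. -/
def GCondition [CompleteSpace H] (γ : H →L[ℂ] H)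
    (Γ : TwoParticle H →L[ℂ] TwoParticle H) : Prop :=
  ∀ A : H →L[ℂ] H, ∃ z t : ℂ,
    HasTensorTrace (opTensor (ContinuousLinearMap.adjoint A) A ∘L
      (Γ + exchange H ∘L opTensor γ 1)) z ∧
    HasTrace (A ∘L γ) t ∧ z.im = 0 ∧ ‖t‖ ^ 2 ≤ z.re

/-- The Q-Condition `Γ + (1 - Ex) (1 ⊗ 1 - γ ⊗ 1 - 1 ⊗ γ) ≥ 0`. -/
def QCondition (γ : H →L[ℂ] H) (Γ : TwoParticle H →L[ℂ] TwoParticle H) : Prop :=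
  0 ≤ Γ + (1 - exchange H) ∘L (opTensor 1 1 - opTensor γ 1 - opTensor 1 γ)

end FermionFock

end

/-! Put `R = √ρ`, a self-adjoint Hilbert–Schmidt operator, and `ω(X) = tr (R X R)` for bounded `X`
on Fock space (`traceWith`). By cyclicity of the trace the hypotheses say that the matrix elements
of `γ` and `Γ` are the values of `ω` on normally ordered products. The functional `ω` is a state,
with `ω(X* X) = ∑ ‖X R bᵢ‖² ≥ 0`, and each condition is this positivity for a suitable `X`.

Let `P(x)` be the linear extension of `f ⊗ g ↦ c*(g) c*(f)`. Then `⟨x, Γ y⟩ = ω(P(y) P(x)*)`, and `y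
= x` is the P-Condition. In the other order, `ω(P(x)* P(y))` becomes by the anticommutation
relations the form of the operator in the Q-Condition (`inner_Q`). One creation operator gives in
the same way `γ ≥ 0`, and `‖c(f)‖ ≤ ‖f‖` gives `γ ≤ 1`.

The traces come from counting particles. The range of `R` lies in the `N`-particle sector
(`sqrt_mem_sector`), where `∑ₖ ‖c(eₖ) ψ‖² = N ‖ψ‖²` (`hasSum_norm_annihilation`). Summing over the
basis gives `tr γ = N`, and counting twice bounds the trace of the positive operator `Γ`.

The G-Condition is the Cauchy–Schwarz inequality `|ω(D)|² ≤ ω(D* D)` for the second quantization `D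
= ∑ₖ c*(eₖ) c(A* eₖ)`: here `ω(D) = tr (A γ)`, and normal ordering gives `ω(D* D) = tr (A* A γ) + tr
((A* ⊗ A) Γ)`. As `D` need not be bounded, the inequality is proved for finite-rank truncations of
`A` and passed to the strong limit (`gTrace_inequality`). Finally both iterated series for the
exchange term sum to `tr (A* A γ)` (`hasTensorTrace_exchange`). -/

namespace FermionFock

open Filter Topology ContinuousLinearMap

/-! ### Hilbert–Schmidt operators -/

section HilbertSchmidt

variable {E F : Type*} [NormedAddCommGroup E] [InnerProductSpace ℂ E]
  [NormedAddCommGroup F] [InnerProductSpace ℂ F]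
variable {ι κ : Type*}

lemma hasSum_norm_inner_sq (b : HilbertBasis ι ℂ E) (x : E) :
    HasSum (fun i => ‖⟪b i, x⟫_ℂ‖ ^ 2) (‖x‖ ^ 2) := by
  have h := b.hasSum_inner_mul_inner x x
  have h2 := Complex.hasSum_re h
  convert h2 using 1
  · ext i
    rw [← inner_conj_symm x (b i), RCLike.conj_mul]
    norm_cast
  · rw [inner_self_eq_norm_sq_to_K]
    norm_cast

/-- Sums of a nonnegative double family may be interchanged. -/
lemma hasSum_swap_of_nonneg {f : ι → κ → ℝ} (hf : ∀ i j, 0 ≤ f i j) {r : ι → ℝ} {c : κ → ℝ}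
    (hr : ∀ i, HasSum (f i) (r i)) (hc : ∀ j, HasSum (fun i => f i j) (c j)) {s : ℝ}
    (hs : HasSum r s) : HasSum c s := by
  have h1 : Summable fun p : ι × κ => f p.1 p.2 := by
    refine (summable_prod_of_nonneg fun p => hf _ _).2 ⟨fun i => (hr i).summable, ?_⟩
    simpa only [(hr _).tsum_eq] using hs.summable
  have h2 : ∑' p : ι × κ, f p.1 p.2 = s := (h1.hasSum.prod_fiberwise hr).unique hs
  have h3 : HasSum (fun p : κ × ι => f p.2 p.1) s := by
    have := h1.hasSum
    rw [h2] at this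
    exact (Equiv.prodComm κ ι).hasSum_iff.2 this
  exact h3.prod_fiberwise hc

variable [CompleteSpace E] [CompleteSpace F]

/-- Both sums are `∑ |⟨fⱼ, K eᵢ⟩|²`, by rows and by columns. For self-adjoint `K` this is the basis
independence of the Hilbert–Schmidt norm. -/
lemma hasSum_norm_sq_adjoint (e : HilbertBasis ι ℂ E) (f : HilbertBasis κ ℂ F) {K : E →L[ℂ] F}
    {s : ℝ} (h : HasSum (fun i => ‖K (e i)‖ ^ 2) s) : HasSum (fun j => ‖adjoint K (f j)‖ ^ 2) s := by
  refine hasSum_swap_of_nonneg (f := fun i j => ‖⟪f j, K (e i)⟫_ℂ‖ ^ 2) (fun i j => by positivity)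
    (fun i => hasSum_norm_inner_sq f _) (fun j => ?_) h
  convert hasSum_norm_inner_sq e (adjoint K (f j)) using 3 with i
  rw [adjoint_inner_right, ← inner_conj_symm, RCLike.norm_conj]

lemma summable_inner_of_norm_sq {G : Type*} [NormedAddCommGroup G] [InnerProductSpace ℂ G]
    {x y : ι → G} (hx : Summable fun i => ‖x i‖ ^ 2) (hy : Summable fun i => ‖y i‖ ^ 2) :
    Summable fun i => ⟪x i, y i⟫_ℂ := by
  refine Summable.of_norm_bounded (hx.add hy) fun i => (norm_inner_le_norm _ _).trans ?_
  nlinarith [sq_nonneg (‖x i‖ - ‖y i‖), sq_nonneg (‖x i‖), sq_nonneg ‖y i‖]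

/-- The two ways to compute the Hilbert–Schmidt inner product. -/
lemma hasSum_inner_adjoint (e : HilbertBasis ι ℂ E) (f : HilbertBasis κ ℂ F) {K L : E →L[ℂ] F}
    (hK : Summable fun i => ‖K (e i)‖ ^ 2) (hL : Summable fun i => ‖L (e i)‖ ^ 2) :
    HasSum (fun i => ⟪K (e i), L (e i)⟫_ℂ) (∑' j, ⟪adjoint L (f j), adjoint K (f j)⟫_ℂ) := by
  have hsq : ∀ {K : E →L[ℂ] F}, (Summable fun i => ‖K (e i)‖ ^ 2) →
      Summable fun p : ι × κ => ‖⟪f p.2, K (e p.1)⟫_ℂ‖ ^ 2 := fun {K} hK => by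
    refine (summable_prod_of_nonneg fun p => by positivity).2
      ⟨fun i => (hasSum_norm_inner_sq f (K (e i))).summable, ?_⟩
    simpa only [(hasSum_norm_inner_sq f (K (e _))).tsum_eq] using hK
  -- Absolute summability of the double family, from `ab ≤ a² + b²`, licenses both orders of
  -- summation.
  have h1 : Summable fun p : ι × κ => ⟪K (e p.1), f p.2⟫_ℂ * ⟪f p.2, L (e p.1)⟫_ℂ := by
    refine Summable.of_norm_bounded ((hsq hK).add (hsq hL)) fun p => ?_
    rw [norm_mul, ← inner_conj_symm, RCLike.norm_conj]
    nlinarith [sq_nonneg (‖⟪f p.2, K (e p.1)⟫_ℂ‖ - ‖⟪f p.2, L (e p.1)⟫_ℂ‖),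
      sq_nonneg ‖⟪f p.2, K (e p.1)⟫_ℂ‖, sq_nonneg ‖⟪f p.2, L (e p.1)⟫_ℂ‖]
  have h2 := h1.hasSum.prod_fiberwise fun i => f.hasSum_inner_mul_inner (K (e i)) (L (e i))
  have h3 := ((Equiv.prodComm κ ι).hasSum_iff.2 h1.hasSum).prod_fiberwise
    (g := fun j => ⟪adjoint L (f j), adjoint K (f j)⟫_ℂ) fun j => by
      have := e.hasSum_inner_mul_inner (adjoint L (f j)) (adjoint K (f j))
      refine (congrArg (HasSum · _) (funext fun i => ?_)).mp this
      rw [adjoint_inner_left, adjoint_inner_right, mul_comm]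
      rfl
  rw [h3.tsum_eq]
  exact h2

end HilbertSchmidt

/-! ### The trace functional of `R²` for a self-adjoint Hilbert–Schmidt operator `R` -/

section TraceFunctional

variable {E : Type*} [NormedAddCommGroup E] [InnerProductSpace ℂ E]
variable {ι κ : Type*}

/-- The functional `X ↦ tr (R X R)`, computed in the basis `e`. -/
noncomputable def traceWith (R : E →L[ℂ] E) (e : HilbertBasis ι ℂ E) (X : E →L[ℂ] E) : ℂ :=
  ∑' i, ⟪R (e i), X (R (e i))⟫_ℂ

variable {R : E →L[ℂ] E} {e : HilbertBasis ι ℂ E}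

lemma summable_norm_sq_comp (hR : Summable fun i => ‖R (e i)‖ ^ 2) (X : E →L[ℂ] E) :
    Summable fun i => ‖X (R (e i))‖ ^ 2 := by
  refine Summable.of_nonneg_of_le (fun i => by positivity) (fun i => ?_) (hR.mul_left (‖X‖ ^ 2))
  rw [← mul_pow]
  exact pow_le_pow_left₀ (norm_nonneg _) (X.le_opNorm _) 2

lemma hasSum_traceWith (hR : Summable fun i => ‖R (e i)‖ ^ 2) (X : E →L[ℂ] E) :
    HasSum (fun i => ⟪R (e i), X (R (e i))⟫_ℂ) (traceWith R e X) :=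
  (summable_inner_of_norm_sq hR (summable_norm_sq_comp hR X)).hasSum

lemma traceWith_add (hR : Summable fun i => ‖R (e i)‖ ^ 2) (X Y : E →L[ℂ] E) :
    traceWith R e (X + Y) = traceWith R e X + traceWith R e Y := by
  refine (hasSum_traceWith hR _).unique ?_
  simpa [inner_add_right] using (hasSum_traceWith hR X).add (hasSum_traceWith hR Y)

lemma traceWith_smul (hR : Summable fun i => ‖R (e i)‖ ^ 2) (z : ℂ) (X : E →L[ℂ] E) :
    traceWith R e (z • X) = z * traceWith R e X := by
  refine (hasSum_traceWith hR _).unique ?_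
  simpa [inner_smul_right] using (hasSum_traceWith hR X).mul_left z

lemma traceWith_neg (hR : Summable fun i => ‖R (e i)‖ ^ 2) (X : E →L[ℂ] E) :
    traceWith R e (-X) = -traceWith R e X := by
  simpa using traceWith_smul hR (-1) X

lemma traceWith_sub (hR : Summable fun i => ‖R (e i)‖ ^ 2) (X Y : E →L[ℂ] E) :
    traceWith R e (X - Y) = traceWith R e X - traceWith R e Y := by
  rw [sub_eq_add_neg, traceWith_add hR, traceWith_neg hR, sub_eq_add_neg]

lemma traceWith_sum (hR : Summable fun i => ‖R (e i)‖ ^ 2) {α : Type*} (s : Finset α)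
    (X : α → E →L[ℂ] E) : traceWith R e (∑ a ∈ s, X a) = ∑ a ∈ s, traceWith R e (X a) := by
  classical
  induction s using Finset.induction with
  | empty => simp [traceWith]
  | insert a s ha ih => rw [Finset.sum_insert ha, Finset.sum_insert ha, traceWith_add hR, ih]

variable [CompleteSpace E]

/-- Expectations of `X* X` are sums of squares. Positivity of the functional and its bounds by
operator norms or particle numbers all come from here. -/
lemma hasSum_norm_sq_traceWith (hR : Summable fun i => ‖R (e i)‖ ^ 2) (X : E →L[ℂ] E) :
    HasSum (fun i => ‖X (R (e i))‖ ^ 2) (traceWith R e (adjoint X ∘L X)).re := by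
  convert Complex.hasSum_re (hasSum_traceWith hR (adjoint X ∘L X)) using 2 with i
  rw [comp_apply, adjoint_inner_right, inner_self_eq_norm_sq_to_K]
  norm_cast

lemma traceWith_adjoint (hR : Summable fun i => ‖R (e i)‖ ^ 2) (X : E →L[ℂ] E) :
    traceWith R e (adjoint X) = starRingEnd ℂ (traceWith R e X) := by
  refine (hasSum_traceWith hR _).unique ?_
  convert (hasSum_traceWith hR X).map (starRingEnd ℂ) continuous_star using 2 with i
  simp [adjoint_inner_right]

lemma traceWith_adjoint_comp_self (hR : Summable fun i => ‖R (e i)‖ ^ 2) (X : E →L[ℂ] E) :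
    0 ≤ (traceWith R e (adjoint X ∘L X)).re ∧ (traceWith R e (adjoint X ∘L X)).im = 0 := by
  refine ⟨(hasSum_norm_sq_traceWith hR X).nonneg fun i => by positivity, ?_⟩
  have := traceWith_adjoint hR (adjoint X ∘L X)
  rw [adjoint_comp, adjoint_adjoint] at this
  exact Complex.conj_eq_iff_im.1 this.symm

/-- The Cauchy–Schwarz inequality for the state `traceWith R e`. -/
lemma norm_traceWith_sq_le (hR : Summable fun i => ‖R (e i)‖ ^ 2)
    (h1 : traceWith R e (ContinuousLinearMap.id ℂ E) = 1) (X : E →L[ℂ] E) :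
    ‖traceWith R e X‖ ^ 2 ≤ (traceWith R e (adjoint X ∘L X)).re := by
  set t := traceWith R e X with ht
  -- The variance of `X`, i.e. the expectation of `(X - t)* (X - t)` with `t` the expectation of
  -- `X`, is nonnegative and equals the expectation of `X* X` minus `|t|²`.
  have h := (traceWith_adjoint_comp_self hR (X - t • ContinuousLinearMap.id ℂ E)).1
  have hexp : adjoint (X - t • ContinuousLinearMap.id ℂ E) ∘L (X - t • ContinuousLinearMap.id ℂ E)
      = adjoint X ∘L X - t • adjoint X - starRingEnd ℂ t • X
        + (starRingEnd ℂ t * t) • ContinuousLinearMap.id ℂ E := by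
    ext x
    simp only [map_sub, map_smulₛₗ, comp_apply, sub_apply, add_apply, smul_apply, id_apply,
      adjoint_id, RingHom.id_apply]
    module
  rw [hexp, traceWith_add hR, traceWith_sub hR, traceWith_sub hR, traceWith_smul hR,
    traceWith_smul hR, traceWith_smul hR, traceWith_adjoint hR, h1, ← ht, mul_one] at h
  have h2 : starRingEnd ℂ t * t = ((‖t‖ ^ 2 : ℝ) : ℂ) := by
    rw [RCLike.conj_mul]; norm_cast
  rw [mul_comm t, h2] at h
  simp only [Complex.add_re, Complex.sub_re, Complex.ofReal_re] at h
  linarith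

/-- Cyclicity `tr (X R²) = tr (R X R) = tr (R² X)`, valid in every basis `f`. The outer traces are
the Hilbert–Schmidt inner products of `R X*` with `R` and of `R` with `R X`; taking adjoints yields
the middle one. -/
lemma hasSum_inner_comp_sq (hR : Summable fun i => ‖R (e i)‖ ^ 2) (hsa : adjoint R = R)
    (f : HilbertBasis κ ℂ E) (X : E →L[ℂ] E) :
    HasSum (fun j => ⟪f j, X (R (R (f j)))⟫_ℂ) (traceWith R e X) ∧
    HasSum (fun j => ⟪f j, R (R (X (f j)))⟫_ℂ) (traceWith R e X) := by
  have hRf : Summable fun j => ‖R (f j)‖ ^ 2 := by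
    simpa only [hsa] using (hasSum_norm_sq_adjoint e f hR.hasSum).summable
  -- `R X` is Hilbert–Schmidt because its adjoint `X* R` is.
  have hRX : ∀ X : E →L[ℂ] E, Summable fun j => ‖(R ∘L X) (f j)‖ ^ 2 := fun X => by
    have := (hasSum_norm_sq_adjoint e f (K := adjoint X ∘L R)
      (summable_norm_sq_comp hR (adjoint X)).hasSum).summable
    simpa only [adjoint_comp, adjoint_adjoint, hsa] using this
  have hadj : ∀ x y, ⟪R x, y⟫_ℂ = ⟪x, R y⟫_ℂ := fun x y => by
    conv_rhs => rw [← hsa, adjoint_inner_right]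
  constructor
  · have h := hasSum_inner_adjoint f e (hRX (adjoint X)) hRf
    simp only [adjoint_comp, adjoint_adjoint, hsa] at h
    convert h using 2 with j
    · rw [comp_apply, hadj, adjoint_inner_left]
    · rfl
  · have h := hasSum_inner_adjoint f e hRf (hRX X)
    simp only [adjoint_comp, hsa] at h
    convert h using 2 with j
    · rw [comp_apply, hadj]
    · unfold traceWith
      exact tsum_congr fun i => by rw [comp_apply, adjoint_inner_left]

omit [CompleteSpace E] in
/-- The functional is continuous along bounded strongly convergent families. -/
lemma tendsto_traceWith (hR : Summable fun i => ‖R (e i)‖ ^ 2) {α : Type*} {l : Filter α}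
    {X : α → E →L[ℂ] E} {Y : E →L[ℂ] E} {C : ℝ} (hC : ∀ a, ‖X a‖ ≤ C)
    (hX : ∀ x, Tendsto (fun a => X a x) l (𝓝 (Y x))) :
    Tendsto (fun a => traceWith R e (X a)) l (𝓝 (traceWith R e Y)) := by
  refine tendsto_tsum_of_dominated_convergence (bound := fun i => C * ‖R (e i)‖ ^ 2)
    (hR.mul_left C) (fun i => Tendsto.inner tendsto_const_nhds (hX _))
    (Eventually.of_forall fun a i => ?_)
  refine (norm_inner_le_norm _ _).trans ?_
  have := (X a).le_of_opNorm_le (hC a) (R (e i))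
  nlinarith [norm_nonneg (R (e i))]

end TraceFunctional

/-! ### Positive operators with finite trace -/

section PositiveTrace

variable {E : Type u} [NormedAddCommGroup E] [InnerProductSpace ℂ E] [CompleteSpace E]
variable {ι : Type*}

lemma adjoint_sqrt (G : E →L[ℂ] E) : adjoint (CFC.sqrt G) = CFC.sqrt G :=
  ((nonneg_iff_isPositive _).1 (CFC.sqrt_nonneg G)).isSelfAdjoint.adjoint_eq

lemma sqrt_sqrt_apply {G : E →L[ℂ] E} (hG : 0 ≤ G) (x : E) :
    CFC.sqrt G (CFC.sqrt G x) = G x :=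
  DFunLike.congr_fun (CFC.sqrt_mul_sqrt_self G hG) x

lemma inner_sqrt_sqrt {G : E →L[ℂ] E} (hG : 0 ≤ G) (x y : E) :
    ⟪CFC.sqrt G x, CFC.sqrt G y⟫_ℂ = ⟪x, G y⟫_ℂ := by
  rw [← sqrt_sqrt_apply hG y, ← adjoint_inner_left (CFC.sqrt G) _ x, adjoint_sqrt]

lemma norm_sqrt_sq {G : E →L[ℂ] E} (hG : 0 ≤ G) (x : E) :
    ‖CFC.sqrt G x‖ ^ 2 = (⟪x, G x⟫_ℂ).re := by
  rw [← inner_sqrt_sqrt hG, inner_self_eq_norm_sq_to_K]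
  norm_cast

lemma summable_norm_sqrt_sq {G : E →L[ℂ] E} (hG : 0 ≤ G) {e : HilbertBasis ι ℂ E}
    (h : Summable fun i => (⟪e i, G (e i)⟫_ℂ).re) : Summable fun i => ‖CFC.sqrt G (e i)‖ ^ 2 := by
  simpa only [norm_sqrt_sq hG] using h

/-- A positive operator with finite trace in one orthonormal basis is trace class. -/
lemma isTraceClass_of_nonneg {G : E →L[ℂ] E} (hG : 0 ≤ G) {e : HilbertBasis ι ℂ E}
    (h : Summable fun i => (⟪e i, G (e i)⟫_ℂ).re) : IsTraceClass G := by
  intro κ f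
  have := (hasSum_norm_sq_adjoint e f (summable_norm_sqrt_sq hG h).hasSum).summable
  rw [adjoint_sqrt] at this
  simpa only [CFC.abs_of_nonneg G hG, norm_sqrt_sq hG] using this

lemma IsTraceClass.summable {G : E →L[ℂ] E} (hG : 0 ≤ G) (h : IsTraceClass G) {κ : Type u}
    (f : HilbertBasis κ ℂ E) : Summable fun i => ‖CFC.sqrt G (f i)‖ ^ 2 := by
  have := h κ f
  rw [CFC.abs_of_nonneg G hG] at this
  exact summable_norm_sqrt_sq hG this

/-- `|B G|² = G B* B G ≤ ‖B‖² G²`, and the square root is operator monotone. -/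
lemma abs_comp_le {G : E →L[ℂ] E} (hG : 0 ≤ G) (B : E →L[ℂ] E) : CFC.abs (B ∘L G) ≤ ‖B‖ • G := by
  have h0 : (0 : E →L[ℂ] E) ≤ ‖B‖ • G := smul_nonneg (norm_nonneg _) hG
  have hsa : adjoint G = G := ((nonneg_iff_isPositive _).1 hG).isSelfAdjoint.adjoint_eq
  rw [← CFC.sqrt_mul_self (‖B‖ • G) h0, CFC.abs]
  refine CFC.sqrt_le_sqrt _ _ ?_
  rw [ContinuousLinearMap.le_def, isPositive_iff_complex]
  intro x
  have key : ⟪(‖B‖ • G * ‖B‖ • G - star (B ∘L G) * (B ∘L G)) x, x⟫_ℂ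
      = (((‖B‖ * ‖G x‖) ^ 2 - ‖B (G x)‖ ^ 2 : ℝ) : ℂ) := by
    have e1 : ⟪star (B ∘L G) (B (G x)), x⟫_ℂ = ((‖B (G x)‖ ^ 2 : ℝ) : ℂ) := by
      rw [star_eq_adjoint, adjoint_inner_left, comp_apply, inner_self_eq_norm_sq_to_K]
      norm_cast
    have e2 : ⟪G (G x), x⟫_ℂ = ((‖G x‖ ^ 2 : ℝ) : ℂ) := by
      conv_lhs => rw [← hsa]
      rw [adjoint_inner_left, hsa, inner_self_eq_norm_sq_to_K]
      norm_cast
    change ⟪‖B‖ • G (‖B‖ • G x) - star (B ∘L G) (B (G x)), x⟫_ℂ = _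
    rw [inner_sub_left, e1, map_smul_of_tower, smul_smul, RCLike.real_smul_eq_coe_smul (K := ℂ),
      inner_smul_left, e2, RCLike.conj_ofReal]
    simp only [RCLike.ofReal_eq_complex_ofReal]
    push_cast
    ring
  rw [key]
  refine ⟨rfl, ?_⟩
  have h2 := pow_le_pow_left₀ (norm_nonneg _) (B.le_opNorm (G x)) 2
  exact sub_nonneg.2 h2

lemma isTraceClass_comp {G : E →L[ℂ] E} (hG : 0 ≤ G) (h : IsTraceClass G) (B : E →L[ℂ] E) :
    IsTraceClass (B ∘L G) := by
  intro κ f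
  have h1 := h κ f
  rw [CFC.abs_of_nonneg G hG] at h1
  refine Summable.of_nonneg_of_le (fun i => ?_) (fun i => ?_) (h1.mul_left ‖B‖)
  · exact ((nonneg_iff_isPositive _).1 (CFC.abs_nonneg (B ∘L G))).re_inner_nonneg_right (f i)
  · have h2 := (ContinuousLinearMap.le_def _ _ |>.1 (abs_comp_le hG B)).re_inner_nonneg_right (f i)
    simp only [sub_apply, inner_sub_right, smul_apply] at h2
    rw [RCLike.real_smul_eq_coe_smul (K := ℂ), inner_smul_right] at h2
    simpa using h2

/-- `tr (B G) = tr (√G B √G)` for positive trace class `G`. -/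
lemma hasTrace_comp {G : E →L[ℂ] E} (hG : 0 ≤ G) (h : IsTraceClass G) {κ : Type u}
    (e : HilbertBasis κ ℂ E) (B : E →L[ℂ] E) :
    HasTrace (B ∘L G) (traceWith (CFC.sqrt G) e B) := by
  refine ⟨isTraceClass_comp hG h B, fun μ f => ?_⟩
  convert (hasSum_inner_comp_sq (h.summable hG e) (adjoint_sqrt G) f B).1 using 3 with i
  rw [sqrt_sqrt_apply hG, comp_apply]

/-- `tr (G B) = tr (√G B √G)` for positive trace class `G`. -/
lemma HasTrace.eq_traceWith {G : E →L[ℂ] E} (hG : 0 ≤ G) (h : IsTraceClass G) {κ : Type u}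
    (e : HilbertBasis κ ℂ E) {B : E →L[ℂ] E} {z : ℂ} (hz : HasTrace (G ∘L B) z) :
    traceWith (CFC.sqrt G) e B = z := by
  refine (hasSum_inner_comp_sq (h.summable hG e) (adjoint_sqrt G) e B).2.unique ?_
  convert hz.2 κ e using 3 with i
  rw [sqrt_sqrt_apply hG, comp_apply]

end PositiveTrace

/-! ### Creation and annihilation operators -/

section CAR

variable {H : Type u} [NormedAddCommGroup H] [InnerProductSpace ℂ H]

lemma creation_coe (f : H) (x : ExteriorAlgebra ℂ H) :
    creation f (x : Fock H) = ((ExteriorAlgebra.ι ℂ f * x : ExteriorAlgebra ℂ H) : Fock H) :=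
  completion_apply_coe _ _

lemma creation_add (f g : H) : creation (f + g) = creation f + creation g := by
  ext x
  induction x using UniformSpace.Completion.induction_on with
  | hp => exact isClosed_eq (map_continuous _) (map_continuous _)
  | ih x =>
    rw [add_apply, creation_coe, creation_coe, creation_coe, map_add, add_mul,
      UniformSpace.Completion.coe_add]

lemma creation_smul (r : ℂ) (f : H) : creation (r • f) = r • creation f := by
  ext x
  induction x using UniformSpace.Completion.induction_on with
  | hp => exact isClosed_eq (map_continuous _) (map_continuous _)
  | ih x =>
    rw [smul_apply, creation_coe, creation_coe, map_smul, smul_mul_assoc,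
      UniformSpace.Completion.coe_smul]

variable (H) in
/-- The creation operators as a linear map. -/
noncomputable def creationLM : H →ₗ[ℂ] Fock H →L[ℂ] Fock H where
  toFun := creation
  map_add' := creation_add
  map_smul' := creation_smul

lemma creation_sum {α : Type*} (s : Finset α) (f : α → H) :
    creation (∑ a ∈ s, f a) = ∑ a ∈ s, creation (f a) := map_sum (creationLM H) f s

lemma norm_creation_le (f : H) : ‖creation f‖ ≤ ‖f‖ := by
  refine opNorm_le_bound _ (norm_nonneg _) fun x => ?_
  induction x using UniformSpace.Completion.induction_on with
  | hp => exact isClosed_le (by fun_prop) (by fun_prop)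
  | ih x =>
    rw [creation_coe, UniformSpace.Completion.norm_coe, UniformSpace.Completion.norm_coe]
    exact norm_ι_mul_le f x

lemma annihilation_smul (r : ℂ) (f : H) :
    annihilation (r • f) = starRingEnd ℂ r • annihilation f := by
  rw [annihilation, creation_smul]
  exact map_smulₛₗ _ _ _

lemma annihilation_sum {α : Type*} (s : Finset α) (f : α → H) :
    annihilation (∑ a ∈ s, f a) = ∑ a ∈ s, annihilation (f a) := by
  simp [annihilation, creation_sum]

lemma adjoint_annihilation (f : H) : adjoint (annihilation f) = creation f := adjoint_adjoint _

lemma norm_annihilation_le (f : H) : ‖annihilation f‖ ≤ ‖f‖ := by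
  rw [annihilation, LinearIsometryEquiv.norm_map]
  exact norm_creation_le f

/-- The annihilation operator acts as the contraction on the exterior algebra. -/
lemma annihilation_coe (f : H) (x : ExteriorAlgebra ℂ H) :
    annihilation f (x : Fock H) = ((contract f x : ExteriorAlgebra ℂ H) : Fock H) := by
  refine ext_inner_right ℂ fun y => ?_
  induction y using UniformSpace.Completion.induction_on with
  | hp => exact isClosed_eq (by fun_prop) (by fun_prop)
  | ih y =>
    rw [annihilation, adjoint_inner_left, creation_coe, UniformSpace.Completion.inner_coe,
      UniformSpace.Completion.inner_coe]
    exact form_ι_mul_right f x y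

/-- The canonical anticommutation relation `c(f) c*(g) = ⟨f, g⟩ - c*(g) c(f)`. -/
lemma annihilation_comp_creation (f g : H) :
    annihilation f ∘L creation g
      = ⟪f, g⟫_ℂ • ContinuousLinearMap.id ℂ (Fock H) - creation g ∘L annihilation f := by
  ext x
  induction x using UniformSpace.Completion.induction_on with
  | hp => exact isClosed_eq (map_continuous _) (map_continuous _)
  | ih x =>
    simp only [comp_apply, sub_apply, smul_apply, id_apply]
    rw [creation_coe, annihilation_coe, annihilation_coe, creation_coe, contract_ι_mul,
      UniformSpace.Completion.coe_sub, UniformSpace.Completion.coe_smul]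

lemma creation_comp_creation (f g : H) : creation f ∘L creation g = -(creation g ∘L creation f) := by
  ext x
  induction x using UniformSpace.Completion.induction_on with
  | hp => exact isClosed_eq (map_continuous _) (map_continuous _)
  | ih x =>
    rw [comp_apply, neg_apply, comp_apply, creation_coe, creation_coe, creation_coe, creation_coe,
      ι_mul_ι_mul, UniformSpace.Completion.coe_neg]

lemma annihilation_comp_annihilation (f g : H) :
    annihilation f ∘L annihilation g = -(annihilation g ∘L annihilation f) := by
  have h := congrArg adjoint (creation_comp_creation g f)
  rw [map_neg, adjoint_comp, adjoint_comp] at h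
  exact h

end CAR

/-! ### Sectors of the Fock space -/

section Sector

variable {H : Type u} [NormedAddCommGroup H] [InnerProductSpace ℂ H]

lemma ι_mul_mem {n : ℕ} (f : H) {x : ExteriorAlgebra ℂ H} (hx : x ∈ ⋀[ℂ]^n H) :
    ExteriorAlgebra.ι ℂ f * x ∈ ⋀[ℂ]^(n + 1) H := by
  rw [ExteriorAlgebra.exteriorPower, pow_succ']
  exact Submodule.mul_mem_mul ⟨f, rfl⟩ hx

/-- Contraction annihilates `⋀⁰` and lowers the degree by one otherwise. -/
lemma contract_mem {n : ℕ} (f : H) {x : ExteriorAlgebra ℂ H} (hx : x ∈ ⋀[ℂ]^n H) :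
    (n = 0 → contract f x = 0) ∧ ∀ m, n = m + 1 → contract f x ∈ ⋀[ℂ]^m H := by
  induction hx using Submodule.pow_induction_on_left' with
  | algebraMap r => exact ⟨fun _ => contract_algebraMap f r, fun m h => by omega⟩
  | add x y n hx hy ihx ihy =>
    refine ⟨fun h => by rw [map_add, ihx.1 h, ihy.1 h, add_zero], fun m h => ?_⟩
    rw [map_add]
    exact Submodule.add_mem _ (ihx.2 m h) (ihy.2 m h)
  | mem_mul g hg n x hx ih =>
    obtain ⟨g, rfl⟩ := hg
    refine ⟨fun h => by omega, fun m h => ?_⟩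
    obtain rfl : n = m := by omega
    rw [contract_ι_mul]
    refine Submodule.sub_mem _ (Submodule.smul_mem _ _ hx) ?_
    cases n with
    | zero => rw [ih.1 rfl, mul_zero]; exact Submodule.zero_mem _
    | succ k => exact ι_mul_mem g (ih.2 k rfl)

/-- Moving each factor of `x` across as a contraction lowers both degrees by one. Either `y` is
exhausted first and is annihilated, or a scalar is paired with an element of positive degree, which
has no scalar component. -/
lemma form_eq_zero_of_ne {m n : ℕ} {x y : ExteriorAlgebra ℂ H} (hx : x ∈ ⋀[ℂ]^m H)
    (hy : y ∈ ⋀[ℂ]^n H) (hmn : m ≠ n) : form x y = 0 := by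
  induction hx using Submodule.pow_induction_on_left' generalizing n y with
  | algebraMap r =>
    obtain ⟨k, rfl⟩ : ∃ k, n = k + 1 := ⟨n - 1, by omega⟩
    rw [Algebra.algebraMap_eq_smul_one, form_smul_left, form_one_left]
    rw [ExteriorAlgebra.exteriorPower, pow_succ'] at hy
    suffices h : ExteriorAlgebra.algebraMapInv y = 0 by rw [h, mul_zero]
    induction hy using Submodule.mul_induction_on' with
    | mem_mul_mem a ha b hb =>
      obtain ⟨a, rfl⟩ := ha
      exact algebraMapInv_ι_mul a b
    | add a _ b _ ha hb => rw [map_add, ha, hb, add_zero]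
  | add x y m hx hy ihx ihy => rw [form_add_left, ihx ‹_› hmn, ihy ‹_› hmn, add_zero]
  | mem_mul g hg m x hx ih =>
    obtain ⟨g, rfl⟩ := hg
    rw [form_ι_mul_left]
    cases n with
    | zero => rw [(contract_mem g hy).1 rfl]; simp [form]
    | succ k => exact ih ((contract_mem g hy).2 k rfl) (by omega)

lemma coe_mem_sector {n : ℕ} {x : ExteriorAlgebra ℂ H} (hx : x ∈ ⋀[ℂ]^n H) :
    (x : Fock H) ∈ sector H n :=
  Submodule.le_topologicalClosure _ ⟨x, hx, rfl⟩

/-- A closed property of vectors holds on a sector if it holds on its algebraic part. -/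
lemma sector_induction {n : ℕ} {p : Fock H → Prop} (hp : IsClosed {ψ | p ψ})
    (h : ∀ x ∈ ⋀[ℂ]^n H, p (x : Fock H)) {ψ : Fock H} (hψ : ψ ∈ sector H n) : p ψ := by
  refine closure_minimal ?_ hp hψ
  rintro _ ⟨x, hx, rfl⟩
  exact h x hx

lemma inner_sector_eq_zero {m n : ℕ} (hmn : m ≠ n) {φ ψ : Fock H} (hφ : φ ∈ sector H m)
    (hψ : ψ ∈ sector H n) : ⟪φ, ψ⟫_ℂ = 0 := by
  refine sector_induction (p := fun φ => ⟪φ, ψ⟫_ℂ = 0)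
    (isClosed_eq (by fun_prop) continuous_const) (fun x hx => ?_) hφ
  refine sector_induction (p := fun ψ => ⟪(x : Fock H), ψ⟫_ℂ = 0)
    (isClosed_eq (by fun_prop) continuous_const) (fun y hy => ?_) hψ
  rw [UniformSpace.Completion.inner_coe]
  exact form_eq_zero_of_ne hx hy hmn

/-- The exterior algebra is dense and is the direct sum of its homogeneous parts. -/
lemma eq_zero_of_orthogonal_sectors {φ : Fock H} (h : ∀ n, ∀ ψ ∈ sector H n, ⟪ψ, φ⟫_ℂ = 0) :
    φ = 0 := by
  refine ext_inner_left ℂ fun ψ => ?_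
  rw [inner_zero_right]
  induction ψ using UniformSpace.Completion.induction_on with
  | hp => exact isClosed_eq (by fun_prop) continuous_const
  | ih x =>
    induction x using DirectSum.Decomposition.inductionOn fun i : ℕ => ⋀[ℂ]^i H with
    | zero => rw [UniformSpace.Completion.coe_zero, inner_zero_left]
    | homogeneous x => exact h _ _ (coe_mem_sector x.2)
    | add x y hx hy => rw [UniformSpace.Completion.coe_add, inner_add_left, hx, hy, add_zero]

lemma annihilation_mem_sector {n : ℕ} (f : H) {ψ : Fock H} (hψ : ψ ∈ sector H (n + 1)) :
    annihilation f ψ ∈ sector H n :=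
  sector_induction (p := fun ψ => annihilation f ψ ∈ sector H n)
    ((Submodule.isClosed_topologicalClosure _).preimage (annihilation f).continuous)
    (fun x hx => by
      rw [annihilation_coe]
      exact coe_mem_sector ((contract_mem f hx).2 n rfl)) hψ

lemma annihilation_eq_zero (f : H) {ψ : Fock H} (hψ : ψ ∈ sector H 0) : annihilation f ψ = 0 :=
  sector_induction (p := fun ψ => annihilation f ψ = 0)
    (isClosed_eq (annihilation f).continuous continuous_const)
    (fun x hx => by
      rw [annihilation_coe, (contract_mem f hx).1 rfl, UniformSpace.Completion.coe_zero]) hψ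

/-- Eigenvectors of the number operator lie in the corresponding sector. -/
lemma mem_sector_of_numberOperator {N : ℕ} {φ : Fock H} (h : φ ∈ (numberOperator H).domain)
    (hφ : numberOperator H ⟨φ, h⟩ = (N : ℂ) • φ) : φ ∈ sector H N := by
  have hs : HasSum (fun n : ℕ => (n : ℂ) • (sector H n).starProjection φ) ((N : ℂ) • φ) := by
    rw [← hφ]
    exact Summable.hasSum h
  -- Pairing the series for the number operator with `ψ` in the sector `m` leaves only the term `n =
  -- m`, so that `m ⟨ψ, φ⟩ = N ⟨ψ, φ⟩`.
  have hz : ∀ m, m ≠ N → ∀ ψ ∈ sector H m, ⟪ψ, φ⟫_ℂ = 0 := fun m hm ψ hψ => by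
    have h1 := hs.mapL (innerSL ℂ ψ)
    simp only [innerSL_apply_apply, inner_smul_right] at h1
    have h2 : HasSum (fun n : ℕ => (n : ℂ) * ⟪ψ, (sector H n).starProjection φ⟫_ℂ)
        ((m : ℂ) * ⟪ψ, (sector H m).starProjection φ⟫_ℂ) :=
      hasSum_single m fun n hn => by
        rw [inner_sector_eq_zero hn.symm hψ (Submodule.starProjection_apply_mem _ _), mul_zero]
    have h3 : ⟪ψ, (sector H m).starProjection φ⟫_ℂ = ⟪ψ, φ⟫_ℂ := by
      rw [← Submodule.inner_starProjection_left_eq_right, Submodule.starProjection_eq_self_iff.2 hψ]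
    have h4 := h2.unique h1
    rw [h3] at h4
    have h5 : ((m : ℂ) - N) * ⟪ψ, φ⟫_ℂ = 0 := by rw [sub_mul, h4, sub_self]
    exact (mul_eq_zero.1 h5).resolve_left (sub_ne_zero.2 (Nat.cast_injective.ne hm))
  have h0 : φ - (sector H N).starProjection φ = 0 := by
    refine eq_zero_of_orthogonal_sectors fun m ψ hψ => ?_
    rw [inner_sub_right]
    by_cases hm : m = N
    · subst hm
      rw [← Submodule.inner_starProjection_left_eq_right, Submodule.starProjection_eq_self_iff.2 hψ,
        sub_self]
    · rw [hz m hm ψ hψ, inner_sector_eq_zero hm hψ (Submodule.starProjection_apply_mem _ _),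
        sub_zero]
  rw [sub_eq_zero.1 h0]
  exact Submodule.starProjection_apply_mem _ _

/-- The square root of a density matrix with `N` particles maps into the `N`-particle sector. -/
lemma sqrt_mem_sector {N : ℕ} {ρ : Fock H →L[ℂ] Fock H} (hρ : 0 ≤ ρ) (h : HasParticleNumber N ρ)
    (ψ : Fock H) : CFC.sqrt ρ ψ ∈ sector H N := by
  have hmem : ∀ ψ, ρ ψ ∈ sector H N := fun ψ => by
    obtain ⟨h1, h2⟩ := h ψ
    exact mem_sector_of_numberOperator h1 h2
  rw [← Submodule.orthogonal_orthogonal (sector H N), Submodule.mem_orthogonal]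
  intro χ hχ
  -- `‖√ρ χ‖² = ⟨χ, ρ χ⟩` vanishes for `χ` orthogonal to the sector. So `√ρ` kills the orthogonal
  -- complement and, being self-adjoint, has its range in the closed sector.
  have h0 : CFC.sqrt ρ χ = 0 := by
    rw [← inner_self_eq_zero (𝕜 := ℂ), inner_sqrt_sqrt hρ]
    exact Submodule.inner_left_of_mem_orthogonal (hmem χ) hχ
  rw [← adjoint_sqrt, adjoint_inner_right, h0, inner_zero_left]

/-- On the `n`-particle sector, `∑ₖ c*(eₖ) c(eₖ) = n`. -/
lemma tendsto_sum_ι_mul_contract {ι : Type*} (e : HilbertBasis ι ℂ H) {n : ℕ}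
    {x : ExteriorAlgebra ℂ H} (hx : x ∈ ⋀[ℂ]^n H) :
    Tendsto (fun s : Finset ι => ∑ k ∈ s, ExteriorAlgebra.ι ℂ (e k) * contract (e k) x) atTop
      (𝓝 ((n : ℂ) • x)) := by
  induction hx using Submodule.pow_induction_on_left' with
  | algebraMap r =>
    have : ∀ k, contract (e k) (algebraMap ℂ (ExteriorAlgebra ℂ H) r) = 0 := fun k =>
      contract_algebraMap _ _
    simp [this]
  | add x y n hx hy ihx ihy =>
    simpa [mul_add, Finset.sum_add_distrib] using ihx.add ihy
  | mem_mul g hg n x hx ih =>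
    obtain ⟨g, rfl⟩ := hg
    have hι : Continuous fun f : H => ExteriorAlgebra.ι ℂ f * x :=
      (((LinearMap.mulRight ℂ x) ∘ₗ ExteriorAlgebra.ι ℂ).mkContinuous ‖x‖ fun f => by
        simpa [mul_comm] using norm_ι_mul_le f x).continuous
    have h1 : Tendsto (fun s : Finset ι => ExteriorAlgebra.ι ℂ (∑ k ∈ s, ⟪e k, g⟫_ℂ • e k) * x) atTop
        (𝓝 (ExteriorAlgebra.ι ℂ g * x)) := by
      refine (hι.tendsto g).comp ?_
      simpa [HasSum, HilbertBasis.repr_apply_apply] using e.hasSum_repr g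
    have h2 := ((wedgeL g).continuous.tendsto _).comp ih
    have h3 := h1.add h2
    -- `eₖ ∧ (eₖ ⌟ (g ∧ x)) = ⟨eₖ, g⟩ eₖ ∧ x + g ∧ (eₖ ∧ (eₖ ⌟ x))`, the two signs cancelling in the
    -- last term. The sums tend to `g ∧ x` and `n g ∧ x`.
    convert h3 using 2 with s
    · simp only [contract_ι_mul, mul_sub, Finset.sum_sub_distrib, map_sum, map_smul,
        Finset.sum_mul, Function.comp_apply]
      rw [sub_eq_add_neg]
      congr 1
      · simp
      · rw [← Finset.sum_neg_distrib]
        refine Finset.sum_congr rfl fun k _ => ?_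
        rw [ι_mul_ι_mul, neg_neg]
        rfl
    · rw [map_smul]
      change _ = _ + (n : ℂ) • (ExteriorAlgebra.ι ℂ g * x)
      push_cast
      rw [add_smul, one_smul, add_comm]

end Sector

/-! ### Counting particles on the completed sectors -/

section Number

variable {H : Type u} [NormedAddCommGroup H] [InnerProductSpace ℂ H]
variable {ι : Type*}

lemma hasSum_norm_annihilation_coe (e : HilbertBasis ι ℂ H) {n : ℕ}
    {x : ExteriorAlgebra ℂ H} (hx : x ∈ ⋀[ℂ]^n H) :
    HasSum (fun k => ‖annihilation (e k) (x : Fock H)‖ ^ 2) (n * ‖(x : Fock H)‖ ^ 2) := by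
  have h := (Complex.continuous_re.tendsto _).comp
    ((tendsto_const_nhds (x := x)).inner (𝕜 := ℂ) (tendsto_sum_ι_mul_contract e hx))
  rw [HasSum, SummationFilter.unconditional_filter]
  refine (congrArg₂ (fun a b => Tendsto a atTop (𝓝 b)) ?_ ?_).mp h
  · ext s
    simp only [Function.comp_apply, inner_sum, Complex.re_sum]
    refine Finset.sum_congr rfl fun k _ => ?_
    rw [annihilation_coe, UniformSpace.Completion.norm_coe, inner_eq_form, form_ι_mul_right,
      ← inner_eq_form, inner_self_eq_norm_sq_to_K]
    norm_cast
  · rw [inner_smul_right, inner_self_eq_norm_sq_to_K, UniformSpace.Completion.norm_coe,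
      ← Complex.ofReal_natCast, ← RCLike.ofReal_pow]
    exact (Complex.re_ofReal_mul _ _).trans (congrArg _ (Complex.ofReal_re _))

/-- `∑ₖ ‖c(eₖ) ψ‖² = n ‖ψ‖²` on the `n`-particle sector. -/
lemma hasSum_norm_annihilation (e : HilbertBasis ι ℂ H) {n : ℕ} {ψ : Fock H}
    (hψ : ψ ∈ sector H n) :
    HasSum (fun k => ‖annihilation (e k) ψ‖ ^ 2) (n * ‖ψ‖ ^ 2) := by
  -- The defect `d s` is a continuous quadratic form, nonnegative on the algebraic part and hence on
  -- the closed sector. The parallelogram law gives `d s ψ ≤ 2 d s x + 2 d s (ψ - x)`, so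
  -- convergence to zero passes from algebraic `x` near `ψ` to `ψ`.
  let d : Finset ι → Fock H → ℝ := fun s ψ => n * ‖ψ‖ ^ 2 - ∑ k ∈ s, ‖annihilation (e k) ψ‖ ^ 2
  have hd0 : ∀ s, ∀ ψ ∈ sector H n, 0 ≤ d s ψ := fun s ψ hψ =>
    sector_induction (p := fun ψ => 0 ≤ d s ψ) (isClosed_le continuous_const (by fun_prop))
      (fun x hx => sub_nonneg.2 (sum_le_hasSum s (fun k _ => by positivity)
        (hasSum_norm_annihilation_coe e hx))) hψ
  have hpar : ∀ s φ χ, d s (φ + χ) + d s (φ - χ) = 2 * d s φ + 2 * d s χ := fun s φ χ => by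
    have h1 : ∀ a b : Fock H, ‖a + b‖ ^ 2 + ‖a - b‖ ^ 2 = 2 * ‖a‖ ^ 2 + 2 * ‖b‖ ^ 2 := fun a b => by
      have := parallelogram_law_with_norm ℂ a b
      nlinarith
    have h2 : ∑ k ∈ s, ‖annihilation (e k) (φ + χ)‖ ^ 2 + ∑ k ∈ s, ‖annihilation (e k) (φ - χ)‖ ^ 2
        = 2 * ∑ k ∈ s, ‖annihilation (e k) φ‖ ^ 2 + 2 * ∑ k ∈ s, ‖annihilation (e k) χ‖ ^ 2 := by
      simp only [← Finset.sum_add_distrib, Finset.mul_sum, map_add, map_sub, h1]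
    have h3 := h1 φ χ
    simp only [d]
    linear_combination (n : ℝ) * h3 - h2
  have hlim : Tendsto (fun s => d s ψ) atTop (𝓝 0) := by
    rw [Metric.tendsto_nhds]
    intro ε hε
    obtain ⟨x, hx, hxψ⟩ : ∃ x ∈ ⋀[ℂ]^n H, 2 * (n * ‖ψ - (x : Fock H)‖ ^ 2) < ε / 2 := by
      have hc : ContinuousAt (fun φ : Fock H => 2 * (n * ‖ψ - φ‖ ^ 2)) ψ := by fun_prop
      have := hc.tendsto.eventually_lt_const (u := ε / 2) (by simpa using hε)
      obtain ⟨_, ⟨x, hx, rfl⟩, h⟩ := (mem_closure_iff_frequently.1 hψ).and_eventually this |>.exists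
      exact ⟨x, hx, h⟩
    have hxt : Tendsto (fun s => d s (x : Fock H)) atTop (𝓝 0) := by
      have h := hasSum_norm_annihilation_coe e hx
      rw [HasSum, SummationFilter.unconditional_filter] at h
      rw [← sub_self (n * ‖(x : Fock H)‖ ^ 2)]
      exact h.const_sub _
    filter_upwards [hxt.eventually_lt_const (show (0 : ℝ) < ε / 4 by positivity)] with s hs
    have hxs := coe_mem_sector hx
    -- Here `2 d s x < 2 (ε / 4)` and `2 d s (ψ - x) < ε / 2`; the discarded term `d s (x - (ψ -
    -- x))` is nonnegative.
    have h1 := hpar s (x : Fock H) (ψ - x)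
    have h2 := hd0 s _ (Submodule.sub_mem _ hxs (Submodule.sub_mem _ hψ hxs))
    have h3 : d s (ψ - x) ≤ n * ‖ψ - (x : Fock H)‖ ^ 2 :=
      sub_le_self _ (Finset.sum_nonneg fun k _ => by positivity)
    have h4 := hd0 s ψ hψ
    rw [add_sub_cancel] at h1
    rw [Real.dist_eq, sub_zero, abs_of_nonneg h4]
    linarith
  have := hlim.const_sub (n * ‖ψ‖ ^ 2)
  simpa [d, HasSum] using this

end Number

/-! ### The two-particle space -/

section TwoParticle

variable {H : Type u} [NormedAddCommGroup H] [InnerProductSpace ℂ H]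

lemma inner_tmul_tmul (f g f' g' : H) : ⟪tmul f g, tmul f' g'⟫_ℂ = ⟪f, f'⟫_ℂ * ⟪g, g'⟫_ℂ := by
  rw [tmul, tmul, UniformSpace.Completion.inner_coe, TensorProduct.inner_tmul]

lemma continuous_tmul : Continuous fun p : H × H => tmul p.1 p.2 :=
  (UniformSpace.Completion.continuous_coe _).comp TensorProduct.continuous_tmul

lemma opTensor_tmul (A B : H →L[ℂ] H) (f g : H) : opTensor A B (tmul f g) = tmul (A f) (B g) :=
  completion_apply_coe _ _

lemma exchange_tmul (f g : H) : exchange H (tmul f g) = tmul g f :=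
  completion_apply_coe _ _

/-- A closed submodule that contains the elementary tensors is everything. -/
lemma mem_of_tmul_mem {M : Submodule ℂ (TwoParticle H)} (hM : IsClosed (M : Set (TwoParticle H)))
    (h : ∀ f g, tmul f g ∈ M) (F : TwoParticle H) : F ∈ M := by
  induction F using UniformSpace.Completion.induction_on with
  | hp => exact hM
  | ih F =>
    induction F using TensorProduct.induction_on with
    | zero => rw [UniformSpace.Completion.coe_zero]; exact M.zero_mem
    | tmul f g => exact h f g
    | add F G hF hG => rw [UniformSpace.Completion.coe_add]; exact M.add_mem hF hG

lemma ext_tmul {S T : TwoParticle H →L[ℂ] TwoParticle H}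
    (h : ∀ f g, S (tmul f g) = T (tmul f g)) : S = T :=
  ContinuousLinearMap.ext fun F =>
    mem_of_tmul_mem (M := LinearMap.eqLocus S.toLinearMap T.toLinearMap)
      (isClosed_eq S.continuous T.continuous) h F

lemma ext_inner_tmul {F G : TwoParticle H} (h : ∀ f g, ⟪tmul f g, F⟫_ℂ = ⟪tmul f g, G⟫_ℂ) :
    F = G := by
  refine sub_eq_zero.1 (inner_self_eq_zero (𝕜 := ℂ).1 ?_)
  have := mem_of_tmul_mem (M := (Submodule.span ℂ {F - G})ᗮ)
    (Submodule.isClosed_orthogonal _) (fun f g => by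
      rw [Submodule.mem_orthogonal_singleton_iff_inner_left, inner_sub_right, h, sub_self]) (F - G)
  exact Submodule.mem_orthogonal_singleton_iff_inner_left.1 this

lemma ext_inner_tmul_op {S T : TwoParticle H →L[ℂ] TwoParticle H}
    (h : ∀ f₁ f₂ g₁ g₂, ⟪tmul f₁ f₂, S (tmul g₁ g₂)⟫_ℂ = ⟪tmul f₁ f₂, T (tmul g₁ g₂)⟫_ℂ) : S = T :=
  ext_tmul fun g₁ g₂ => ext_inner_tmul fun f₁ f₂ => h f₁ f₂ g₁ g₂

/-- Additive-in-each-argument functions on the tensor product that agree on elementary tensors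
agree. -/
lemma eq_of_tmul {φ χ : H ⊗[ℂ] H → H ⊗[ℂ] H → ℂ}
    (hφl : ∀ x y z, φ (x + y) z = φ x z + φ y z) (hφr : ∀ x y z, φ x (y + z) = φ x y + φ x z)
    (hχl : ∀ x y z, χ (x + y) z = χ x z + χ y z) (hχr : ∀ x y z, χ x (y + z) = χ x y + χ x z)
    (h : ∀ f₁ f₂ g₁ g₂, φ (f₁ ⊗ₜ f₂) (g₁ ⊗ₜ g₂) = χ (f₁ ⊗ₜ f₂) (g₁ ⊗ₜ g₂)) (x y : H ⊗[ℂ] H) :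
    φ x y = χ x y := by
  induction x using TensorProduct.induction_on with
  | zero =>
    have h1 := hφl 0 0 y
    have h2 := hχl 0 0 y
    rw [add_zero, left_eq_add] at h1 h2
    rw [h1, h2]
  | tmul f₁ f₂ =>
    induction y using TensorProduct.induction_on with
    | zero =>
      have h1 := hφr (f₁ ⊗ₜ f₂) 0 0
      have h2 := hχr (f₁ ⊗ₜ f₂) 0 0
      rw [add_zero, left_eq_add] at h1 h2
      rw [h1, h2]
    | tmul g₁ g₂ => exact h f₁ f₂ g₁ g₂
    | add y z hy hz => rw [hφr, hχr, hy, hz]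
  | add x y hx hy => rw [hφl, hχl, hx, hy]

/-- Both conditions are closed, so positivity may be tested on the algebraic tensor product.
Elementary tensors alone would not suffice. -/
lemma nonneg_of_inner_coe {B : TwoParticle H →L[ℂ] TwoParticle H}
    (h : ∀ x : H ⊗[ℂ] H, 0 ≤ (⟪(x : TwoParticle H), B x⟫_ℂ).re ∧
      (⟪(x : TwoParticle H), B x⟫_ℂ).im = 0) : 0 ≤ B := by
  rw [nonneg_iff_isPositive, isPositive_iff_complex]
  have hF : ∀ F : TwoParticle H, 0 ≤ (⟪F, B F⟫_ℂ).re ∧ (⟪F, B F⟫_ℂ).im = 0 := fun F => by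
    induction F using UniformSpace.Completion.induction_on with
    | hp =>
      have hc : Continuous fun F : TwoParticle H => ⟪F, B F⟫_ℂ := by fun_prop
      exact (isClosed_le continuous_const (Complex.continuous_re.comp hc)).inter
        (isClosed_eq (Complex.continuous_im.comp hc) continuous_const)
    | ih x => exact h x
  intro F
  obtain ⟨h1, h2⟩ := hF F
  have h3 : ⟪B F, F⟫_ℂ = ⟪F, B F⟫_ℂ := by
    rw [← inner_conj_symm]
    exact Complex.conj_eq_iff_im.2 h2
  rw [h3]
  exact ⟨Complex.ext (by simp) (by simp [h2]), h1⟩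

lemma norm_opTensor_le (A B : H →L[ℂ] H) : ‖opTensor A B‖ ≤ ‖A‖ * ‖B‖ := by
  refine opNorm_le_bound _ (by positivity) fun F => ?_
  induction F using UniformSpace.Completion.induction_on with
  | hp => exact isClosed_le (by fun_prop) (by fun_prop)
  | ih x =>
    rw [opTensor, completion_apply_coe, UniformSpace.Completion.norm_coe,
      UniformSpace.Completion.norm_coe]
    exact (le_opNorm _ _).trans (by gcongr; exact TensorProduct.norm_mapL_le A B)

lemma adjoint_opTensor [CompleteSpace H] (A B : H →L[ℂ] H) :
    adjoint (opTensor A B) = opTensor (adjoint A) (adjoint B) := by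
  refine ext_inner_tmul_op fun f₁ f₂ g₁ g₂ => ?_
  rw [adjoint_inner_right, opTensor_tmul, opTensor_tmul, inner_tmul_tmul, inner_tmul_tmul,
    adjoint_inner_right, adjoint_inner_right]

/-- The orthonormal basis `(eₖ ⊗ eₗ)` of the two-particle space. -/
noncomputable def tensorBasis {ι : Type*} (e : HilbertBasis ι ℂ H) :
    HilbertBasis (ι × ι) ℂ (TwoParticle H) :=
  HilbertBasis.mk (v := fun p : ι × ι => tmul (e p.1) (e p.2))
    (by
      classical
      rw [orthonormal_iff_ite]
      rintro ⟨i, j⟩ ⟨k, l⟩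
      rw [inner_tmul_tmul, orthonormal_iff_ite.1 e.orthonormal, orthonormal_iff_ite.1 e.orthonormal]
      split_ifs <;> simp_all)
    (by
      rw [top_le_iff, eq_top_iff]
      intro F _
      set M := (Submodule.span ℂ (Set.range fun p : ι × ι => tmul (e p.1) (e p.2))).topologicalClosure
        with hM
      have hcl : IsClosed (M : Set (TwoParticle H)) := Submodule.isClosed_topologicalClosure _
      -- A bounded map that sends the basis into the closed subspace `M` sends all of `H` into it.
      -- Applied in each slot of the tensor product in turn, this puts every `f ⊗ g` into `M`.
      have hl : ∀ (N : H →L[ℂ] TwoParticle H), (∀ k, N (e k) ∈ M) → ∀ f, N f ∈ M := fun N hN f => by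
        have h1 : (Submodule.span ℂ (Set.range e)).topologicalClosure ≤ M.comap N.toLinearMap :=
          Submodule.topologicalClosure_minimal _
            (Submodule.span_le.2 (by rintro _ ⟨k, rfl⟩; exact hN k)) (hcl.preimage N.continuous)
        rw [e.dense_span] at h1
        exact h1 trivial
      let T : H →L[ℂ] H →L[ℂ] TwoParticle H :=
        (compL ℂ H (H ⊗[ℂ] H) (TwoParticle H) UniformSpace.Completion.toComplL) ∘L
          TensorProduct.mkL ℂ H H
      refine mem_of_tmul_mem hcl (fun f g => hl (T f) (fun l => ?_) g) F
      refine hl (T.flip (e l)) (fun k => ?_) f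
      exact Submodule.le_topologicalClosure _ (Submodule.subset_span ⟨(k, l), rfl⟩))

lemma tensorBasis_apply {ι : Type*} (e : HilbertBasis ι ℂ H) (p : ι × ι) :
    tensorBasis e p = tmul (e p.1) (e p.2) := by
  rw [tensorBasis, HilbertBasis.coe_mk]

end TwoParticle

/-! ### Strong convergence -/

section Strong

/-- A bounded family of operators that converges strongly on a dense set converges strongly. -/
lemma tendsto_of_dense {E F : Type*} [NormedAddCommGroup E] [NormedSpace ℂ E]
    [NormedAddCommGroup F] [NormedSpace ℂ F] {α : Type*} {l : Filter α} {X : α → E →L[ℂ] F}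
    {Y : E →L[ℂ] F} {C : ℝ} (hC : ∀ a, ‖X a‖ ≤ C) {D : Set E} (hD : Dense D)
    (h : ∀ x ∈ D, Tendsto (fun a => X a x) l (𝓝 (Y x))) (x : E) :
    Tendsto (fun a => X a x) l (𝓝 (Y x)) := by
  rw [Metric.tendsto_nhds]
  intro ε hε
  have hc : ContinuousAt (fun y => C * ‖x - y‖ + ‖Y (y - x)‖) x := by fun_prop
  have h1 := hc.tendsto.eventually_lt_const (u := ε / 2) (by simpa using hε)
  obtain ⟨y, hyD, hy⟩ := (mem_closure_iff_frequently.1 (hD x)).and_eventually h1 |>.exists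
  filter_upwards [(Metric.tendsto_nhds.1 (h y hyD)) (ε / 2) (by positivity)] with a ha
  rw [dist_eq_norm] at ha ⊢
  have h2 : X a x - Y x = X a (x - y) + (X a y - Y y) + Y (y - x) := by
    simp only [map_sub]; abel
  rw [h2]
  have h3 := (X a).le_of_opNorm_le (hC a) (x - y)
  have h4 := norm_add₃_le (a := X a (x - y)) (b := X a y - Y y) (c := Y (y - x))
  linarith

variable {H : Type u} [NormedAddCommGroup H] [InnerProductSpace ℂ H]

lemma tendsto_opTensor {α : Type*} {l : Filter α} {A B : α → H →L[ℂ] H} {A' B' : H →L[ℂ] H}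
    {C D : ℝ} (hC : ∀ a, ‖A a‖ ≤ C) (hD : ∀ a, ‖B a‖ ≤ D)
    (hA : ∀ x, Tendsto (fun a => A a x) l (𝓝 (A' x)))
    (hB : ∀ x, Tendsto (fun a => B a x) l (𝓝 (B' x))) (F : TwoParticle H) :
    Tendsto (fun a => opTensor (A a) (B a) F) l (𝓝 (opTensor A' B' F)) := by
  refine tendsto_of_dense (C := C * D) (fun a => (norm_opTensor_le _ _).trans ?_)
    (D := Set.range ((↑) : H ⊗[ℂ] H → TwoParticle H)) UniformSpace.Completion.denseRange_coe ?_ F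
  · exact mul_le_mul (hC a) (hD a) (norm_nonneg _) ((norm_nonneg _).trans (hC a))
  · rintro _ ⟨x, rfl⟩
    induction x using TensorProduct.induction_on with
    | zero => simp only [UniformSpace.Completion.coe_zero, map_zero]; exact tendsto_const_nhds
    | tmul f g =>
      have h1 : Tendsto (fun a => (A a f, B a g)) l (𝓝 (A' f, B' g)) := (hA f).prodMk_nhds (hB g)
      have h2 := (continuous_tmul.tendsto (A' f, B' g)).comp h1
      have h3 : ∀ (A B : H →L[ℂ] H), opTensor A B ((f ⊗ₜ[ℂ] g : H ⊗[ℂ] H) : TwoParticle H)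
          = tmul (A f) (B g) := fun A B => opTensor_tmul A B f g
      simp only [h3]
      exact h2
    | add x y hx hy =>
      simp only [UniformSpace.Completion.coe_add, map_add]
      exact hx.add hy

/-- Products are jointly strongly continuous only on bounded sets: the bound on `A a` controls `A a
(B a x - B' x)`. -/
lemma tendsto_comp {α : Type*} {l : Filter α} {A B : α → H →L[ℂ] H} {A' B' : H →L[ℂ] H}
    {C : ℝ} (hC : ∀ a, ‖A a‖ ≤ C)
    (hA : ∀ x, Tendsto (fun a => A a x) l (𝓝 (A' x)))
    (hB : ∀ x, Tendsto (fun a => B a x) l (𝓝 (B' x))) (x : H) :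
    Tendsto (fun a => (A a ∘L B a) x) l (𝓝 ((A' ∘L B') x)) := by
  have h1 : Tendsto (fun a => C * ‖B a x - B' x‖) l (𝓝 0) := by
    simpa using (((hB x).sub_const (B' x)).norm.const_mul C)
  have h2 : Tendsto (fun a => A a (B a x - B' x)) l (𝓝 0) :=
    squeeze_zero_norm (fun a => (A a).le_of_opNorm_le (hC a) _) h1
  have h3 := h2.add (hA (B' x))
  simpa using h3

/-- The orthogonal projection onto the span of finitely many basis vectors. -/
noncomputable def basisProj {ι : Type*} (e : HilbertBasis ι ℂ H) (s : Finset ι) : H →L[ℂ] H :=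
  ∑ k ∈ s, (innerSL ℂ (e k)).smulRight (e k)

lemma basisProj_apply {ι : Type*} (e : HilbertBasis ι ℂ H) (s : Finset ι) (x : H) :
    basisProj e s x = ∑ k ∈ s, ⟪e k, x⟫_ℂ • e k := by
  simp [basisProj, sum_apply]

lemma basisProj_basis {ι : Type*} [DecidableEq ι] (e : HilbertBasis ι ℂ H) (s : Finset ι) (k : ι) :
    basisProj e s (e k) = if k ∈ s then e k else 0 := by
  simp [basisProj_apply, orthonormal_iff_ite.1 e.orthonormal]

lemma tendsto_basisProj {ι : Type*} (e : HilbertBasis ι ℂ H) (x : H) :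
    Tendsto (fun s => basisProj e s x) atTop (𝓝 x) := by
  simpa [HasSum, basisProj_apply, HilbertBasis.repr_apply_apply] using e.hasSum_repr x

variable [CompleteSpace H]

lemma adjoint_basisProj {ι : Type*} (e : HilbertBasis ι ℂ H) (s : Finset ι) :
    adjoint (basisProj e s) = basisProj e s := by
  refine (eq_adjoint_iff _ _).2 (fun x y => ?_) |>.symm
  simp only [basisProj_apply, sum_inner, inner_sum, inner_smul_left, inner_smul_right,
    inner_conj_symm]
  exact Finset.sum_congr rfl fun k _ => mul_comm _ _

lemma norm_basisProj_le {ι : Type*} (e : HilbertBasis ι ℂ H) (s : Finset ι) :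
    ‖basisProj e s‖ ≤ 1 := by
  classical
  have hidem : ∀ x, basisProj e s (basisProj e s x) = basisProj e s x := fun x => by
    rw [basisProj_apply e s x, map_sum]
    refine Finset.sum_congr rfl fun k hk => ?_
    rw [map_smul, basisProj_basis, if_pos hk]
  refine opNorm_le_bound _ zero_le_one fun x => ?_
  have h1 : ‖basisProj e s x‖ ^ 2 ≤ ‖basisProj e s x‖ * ‖x‖ := by
    have h2 : ⟪basisProj e s x, basisProj e s x⟫_ℂ = ⟪basisProj e s x, x⟫_ℂ := by
      conv_lhs => rw [← adjoint_inner_right, adjoint_basisProj, hidem, ← adjoint_basisProj,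
        adjoint_inner_right]
    have h3 := norm_inner_le_norm (𝕜 := ℂ) (basisProj e s x) x
    rw [← h2, inner_self_eq_norm_sq_to_K] at h3
    simpa using h3
  by_contra! hlt
  nlinarith [norm_nonneg x]

/-- The truncation of `A` to the span of finitely many basis vectors. -/
noncomputable def truncate {ι : Type*} (e : HilbertBasis ι ℂ H) (A : H →L[ℂ] H) (s : Finset ι) :
    H →L[ℂ] H :=
  basisProj e s ∘L A ∘L basisProj e s

variable {ι : Type*} (e : HilbertBasis ι ℂ H) (A : H →L[ℂ] H)

lemma norm_truncate_le (s : Finset ι) : ‖truncate e A s‖ ≤ ‖A‖ := by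
  have h := norm_basisProj_le e s
  calc ‖truncate e A s‖ ≤ ‖basisProj e s‖ * (‖A‖ * ‖basisProj e s‖) :=
        (opNorm_comp_le _ _).trans (by gcongr; exact opNorm_comp_le _ _)
    _ ≤ 1 * (‖A‖ * 1) := by gcongr
    _ = ‖A‖ := by ring

lemma adjoint_truncate (s : Finset ι) : adjoint (truncate e A s) = truncate e (adjoint A) s := by
  simp [truncate, adjoint_comp, adjoint_basisProj, comp_assoc]

lemma tendsto_truncate (x : H) : Tendsto (fun s => truncate e A s x) atTop (𝓝 (A x)) := by
  refine tendsto_comp (A' := ContinuousLinearMap.id ℂ H) (B' := A) (norm_basisProj_le e)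
    (tendsto_basisProj e) (fun x => ?_) x
  exact (A.continuous.tendsto _).comp (tendsto_basisProj e x)

omit [CompleteSpace H] in
lemma truncate_basis_of_notMem {s : Finset ι} {k : ι} (hk : k ∉ s) : truncate e A s (e k) = 0 := by
  classical
  simp [truncate, basisProj_basis, hk]

omit [CompleteSpace H] in
/-- Vectors in the range of a truncation are finite linear combinations of basis vectors. -/
lemma sum_inner_truncate (s : Finset ι) (x : H) :
    ∑ k ∈ s, ⟪e k, truncate e A s x⟫_ℂ • e k = truncate e A s x := by
  classical
  rw [← basisProj_apply]
  simp only [truncate, comp_apply]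
  rw [basisProj_apply e s (A _), map_sum]
  refine Finset.sum_congr rfl fun k hk => ?_
  rw [map_smul, basisProj_basis, if_pos hk]

end Strong

/-! ### Pairs of reduced density matrices -/

section Reduced

variable {H : Type u} [NormedAddCommGroup H] [InnerProductSpace ℂ H]

/-- `R` is the square root of a density matrix with `N` particles whose reduced density matrices are
`γ` and `Γ`. -/
structure Represents {κ : Type*} (R : Fock H →L[ℂ] Fock H) (b : HilbertBasis κ ℂ (Fock H)) (N : ℕ)
    (γ : H →L[ℂ] H) (Γ : TwoParticle H →L[ℂ] TwoParticle H) : Prop where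
  summable : Summable fun i => ‖R (b i)‖ ^ 2
  unit : traceWith R b (ContinuousLinearMap.id ℂ (Fock H)) = 1
  mem_sector : ∀ ψ, R ψ ∈ sector H N
  one : ∀ f g, ⟪f, γ g⟫_ℂ = traceWith R b (creation g ∘L annihilation f)
  two : ∀ f₁ f₂ g₁ g₂, ⟪tmul f₁ f₂, Γ (tmul g₁ g₂)⟫_ℂ
    = traceWith R b (creation g₂ ∘L creation g₁ ∘L annihilation f₁ ∘L annihilation f₂)

/-- Trades `tr (ρ X)` for the functional of `√ρ`, which is defined, linear and positive for all
bounded `X`. -/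
lemma IsNRepresentable.exists_represents {N : ℕ} {γ : H →L[ℂ] H}
    {Γ : TwoParticle H →L[ℂ] TwoParticle H} (h : IsNRepresentable N γ Γ) :
    ∃ (κ : Type u) (R : Fock H →L[ℂ] Fock H) (b : HilbertBasis κ ℂ (Fock H)),
      Represents R b N γ Γ := by
  obtain ⟨ρ, ⟨hρ, htr⟩, hN, h1, h2⟩ := h
  obtain ⟨w, b, -⟩ := exists_hilbertBasis ℂ (Fock H)
  refine ⟨w, CFC.sqrt ρ, b, htr.1.summable hρ b, ?_, sqrt_mem_sector hρ hN, fun f g => ?_,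
    fun f₁ f₂ g₁ g₂ => ?_⟩
  -- The normalization `tr ρ = 1`, read as the trace of `ρ` composed with the identity.
  · exact HasTrace.eq_traceWith hρ htr.1 b htr
  · exact (HasTrace.eq_traceWith hρ htr.1 b (h1 f g)).symm
  · exact (HasTrace.eq_traceWith hρ htr.1 b (h2 f₁ f₂ g₁ g₂)).symm

variable (H) in
/-- The linear map `f ⊗ g ↦ c*(g) c*(f)`. -/
noncomputable def pairCreation : H ⊗[ℂ] H →ₗ[ℂ] Fock H →L[ℂ] Fock H :=
  TensorProduct.lift ((LinearMap.mul ℂ (Fock H →L[ℂ] Fock H)).flip.compl₁₂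
    (creationLM H) (creationLM H))

lemma pairCreation_tmul (f g : H) :
    pairCreation H (f ⊗ₜ g) = creation g ∘L creation f := rfl

lemma adjoint_pairCreation_tmul (f g : H) :
    adjoint (pairCreation H (f ⊗ₜ g)) = annihilation f ∘L annihilation g := by
  rw [pairCreation_tmul, adjoint_comp]
  rfl

variable {κ : Type*} {R : Fock H →L[ℂ] Fock H} {b : HilbertBasis κ ℂ (Fock H)} {N : ℕ}
  {γ : H →L[ℂ] H} {Γ : TwoParticle H →L[ℂ] TwoParticle H}

namespace Represents

variable (h : Represents R b N γ Γ)

include h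

lemma hasSum_norm_sq : HasSum (fun i => ‖R (b i)‖ ^ 2) 1 := by
  have := hasSum_norm_sq_traceWith h.summable (ContinuousLinearMap.id ℂ (Fock H))
  rw [adjoint_id, id_comp, h.unit] at this
  exact this

lemma inner_γ_self (f : H) :
    ⟪f, γ f⟫_ℂ = traceWith R b (adjoint (annihilation f) ∘L annihilation f) := by
  rw [h.one, adjoint_annihilation]

lemma inner_γ_self_nonneg (f : H) : 0 ≤ (⟪f, γ f⟫_ℂ).re ∧ (⟪f, γ f⟫_ℂ).im = 0 := by
  rw [h.inner_γ_self]
  exact traceWith_adjoint_comp_self h.summable _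

/-- The exclusion principle in the form `‖c(f)‖ ≤ ‖f‖`, averaged over a state of total mass one. -/
lemma inner_γ_self_le (f : H) : (⟪f, γ f⟫_ℂ).re ≤ ‖f‖ ^ 2 := by
  rw [h.inner_γ_self]
  have h1 := hasSum_norm_sq_traceWith h.summable (annihilation f)
  have h2 := h.hasSum_norm_sq.mul_left (‖f‖ ^ 2)
  rw [mul_one] at h2
  refine hasSum_le (fun i => ?_) h1 h2
  rw [← mul_pow]
  exact pow_le_pow_left₀ (norm_nonneg _)
    ((annihilation f).le_of_opNorm_le (norm_annihilation_le f) _) 2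

/-- Each vector `R bᵢ` carries `N` particles, so `∑ₖ ‖c(eₖ) R bᵢ‖² = N ‖R bᵢ‖²`; summing over `i`
and interchanging the sums gives `N`. -/
lemma hasSum_γ {ι : Type*} (e : HilbertBasis ι ℂ H) :
    HasSum (fun k => ⟪e k, γ (e k)⟫_ℂ) (N : ℂ) := by
  have h1 : HasSum (fun k => (⟪e k, γ (e k)⟫_ℂ).re) (N : ℝ) := by
    have h2 := h.hasSum_norm_sq.mul_left (N : ℝ)
    rw [mul_one] at h2
    refine hasSum_swap_of_nonneg (f := fun i k => ‖annihilation (e k) (R (b i))‖ ^ 2)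
      (fun i k => by positivity) (fun i => hasSum_norm_annihilation e (h.mem_sector _))
      (fun k => ?_) h2
    rw [h.inner_γ_self]
    exact hasSum_norm_sq_traceWith h.summable _
  have h2 := Complex.hasSum_ofReal.2 h1
  rw [Complex.ofReal_natCast] at h2
  refine (congrArg (HasSum · _) (funext fun k => ?_)).mp h2
  symm
  exact Complex.ext (by simp) (by simp [(h.inner_γ_self_nonneg (e k)).2])

/-- Both sides are sesquilinear, so the definition of `Γ` on elementary tensors extends to finite
sums of them, which is what positivity requires. -/
lemma inner_Γ (x y : H ⊗[ℂ] H) : ⟪(x : TwoParticle H), Γ y⟫_ℂ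
    = traceWith R b (pairCreation H y ∘L adjoint (pairCreation H x)) := by
  refine eq_of_tmul (φ := fun x y => ⟪(x : TwoParticle H), Γ y⟫_ℂ)
    (χ := fun x y => traceWith R b (pairCreation H y ∘L adjoint (pairCreation H x)))
    (fun x y z => ?_) (fun x y z => ?_) (fun x y z => ?_) (fun x y z => ?_) (fun f₁ f₂ g₁ g₂ => ?_) x y
  · rw [UniformSpace.Completion.coe_add, inner_add_left]
  · rw [UniformSpace.Completion.coe_add, map_add, inner_add_right]
  · rw [map_add, map_add, comp_add, traceWith_add h.summable]
  · rw [map_add, add_comp, traceWith_add h.summable]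
  · rw [adjoint_pairCreation_tmul, pairCreation_tmul, comp_assoc]
    exact h.two f₁ f₂ g₁ g₂

lemma pCondition : PCondition Γ := by
  refine nonneg_of_inner_coe fun x => ?_
  rw [h.inner_Γ]
  have := traceWith_adjoint_comp_self h.summable (adjoint (pairCreation H x))
  rwa [adjoint_adjoint] at this

lemma two_swap_left (f₁ f₂ g₁ g₂ : H) :
    ⟪tmul f₂ f₁, Γ (tmul g₁ g₂)⟫_ℂ = -⟪tmul f₁ f₂, Γ (tmul g₁ g₂)⟫_ℂ := by
  rw [h.two, h.two, annihilation_comp_annihilation f₂ f₁, comp_neg, comp_neg,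
    traceWith_neg h.summable]

lemma two_swap_right (f₁ f₂ g₁ g₂ : H) :
    ⟪tmul f₁ f₂, Γ (tmul g₂ g₁)⟫_ℂ = -⟪tmul f₁ f₂, Γ (tmul g₁ g₂)⟫_ℂ := by
  rw [h.two, h.two, ← comp_assoc (creation g₁), creation_comp_creation g₁ g₂, neg_comp, comp_assoc,
    traceWith_neg h.summable]

lemma exchange_right : Γ ∘L exchange H = -Γ := by
  refine ext_inner_tmul_op fun f₁ f₂ g₁ g₂ => ?_
  rw [comp_apply, exchange_tmul, h.two_swap_right, neg_apply, inner_neg_right]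

/-- `∑ₖₗ ⟨eₖ ⊗ eₗ, Γ (eₖ ⊗ eₗ)⟩ < ∞`. -/
lemma summable_Γ {ι : Type*} (e : HilbertBasis ι ℂ H) :
    Summable fun p => (⟪tensorBasis e p, Γ (tensorBasis e p)⟫_ℂ).re := by
  classical
  have hp : ∀ p, HasSum (fun i => ‖annihilation (e p.1) (annihilation (e p.2) (R (b i)))‖ ^ 2)
      (⟪tensorBasis e p, Γ (tensorBasis e p)⟫_ℂ).re := fun p => by
    rw [tensorBasis_apply, h.two]
    have := hasSum_norm_sq_traceWith h.summable (annihilation (e p.1) ∘L annihilation (e p.2))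
    rw [adjoint_comp, adjoint_annihilation, adjoint_annihilation, comp_assoc] at this
    exact this
  have hs1 : ∀ (n : ℕ) (ψ : Fock H), ψ ∈ sector H n → ∀ s : Finset ι,
      ∑ k ∈ s, ‖annihilation (e k) ψ‖ ^ 2 ≤ n * ‖ψ‖ ^ 2 := fun n ψ hψ s =>
    sum_le_hasSum s (fun k _ => by positivity) (hasSum_norm_annihilation e hψ)
  have hs2 : ∀ ψ ∈ sector H N, ∀ s : Finset ι,
      ∑ l ∈ s, ∑ k ∈ s, ‖annihilation (e k) (annihilation (e l) ψ)‖ ^ 2 ≤ N * (N * ‖ψ‖ ^ 2) := by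
    intro ψ hψ s
    calc ∑ l ∈ s, ∑ k ∈ s, ‖annihilation (e k) (annihilation (e l) ψ)‖ ^ 2
        ≤ ∑ l ∈ s, N * ‖annihilation (e l) ψ‖ ^ 2 := Finset.sum_le_sum fun l _ => ?_
      _ = N * ∑ l ∈ s, ‖annihilation (e l) ψ‖ ^ 2 := Finset.mul_sum .. |>.symm
      _ ≤ N * (N * ‖ψ‖ ^ 2) := by gcongr; exact hs1 N ψ hψ s
    -- After one annihilation `N - 1` particles are left, and `N - 1 ≤ N` suffices. The vacuum
    -- sector is treated apart, as it has no sector below it.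
    cases N with
    | zero => simp [annihilation_eq_zero _ hψ]
    | succ n =>
      refine (hs1 n _ (annihilation_mem_sector (e l) hψ) s).trans ?_
      gcongr
      simp
  refine summable_of_sum_le (c := N * N) (fun p => (hp p).nonneg fun i => by positivity) fun u => ?_
  refine hasSum_le (fun i => ?_) (hasSum_sum fun p _ => hp p)
    ((h.hasSum_norm_sq.mul_left (N : ℝ)).mul_left (N : ℝ)) |>.trans (by simp)
  -- The finite set `u` of index pairs is enlarged to a square, over which the two annihilations are
  -- counted one after the other.
  let s := u.image Prod.fst ∪ u.image Prod.snd
  have hu : u ⊆ s ×ˢ s := fun p hp => Finset.mem_product.2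
    ⟨Finset.mem_union_left _ (Finset.mem_image_of_mem _ hp),
      Finset.mem_union_right _ (Finset.mem_image_of_mem _ hp)⟩
  refine (Finset.sum_le_sum_of_subset_of_nonneg hu fun p _ _ => by positivity).trans ?_
  rw [Finset.sum_product_right]
  exact hs2 _ (h.mem_sector _) s

/-- `⟨x, (Γ + (1 - Ex) (1 ⊗ 1 - γ ⊗ 1 - 1 ⊗ γ)) y⟩` is the expectation of `c(x) c*(y)`. -/
lemma inner_Q (x y : H ⊗[ℂ] H) : ⟪(x : TwoParticle H), (Γ + (1 - exchange H) ∘L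
      (opTensor 1 1 - opTensor γ 1 - opTensor 1 γ) : TwoParticle H →L[ℂ] TwoParticle H) y⟫_ℂ
    = traceWith R b (adjoint (pairCreation H x) ∘L pairCreation H y) := by
  set Q := Γ + (1 - exchange H) ∘L (opTensor 1 1 - opTensor γ 1 - opTensor 1 γ) with hQ
  refine eq_of_tmul (φ := fun x y => ⟪(x : TwoParticle H), Q y⟫_ℂ)
    (χ := fun x y => traceWith R b (adjoint (pairCreation H x) ∘L pairCreation H y))
    (fun x y z => ?_) (fun x y z => ?_) (fun x y z => ?_) (fun x y z => ?_) (fun f₁ f₂ g₁ g₂ => ?_) x y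
  · rw [UniformSpace.Completion.coe_add, inner_add_left]
  · rw [UniformSpace.Completion.coe_add, map_add, inner_add_right]
  · rw [map_add, map_add, add_comp, traceWith_add h.summable]
  · rw [map_add, comp_add, traceWith_add h.summable]
  · change ⟪tmul f₁ f₂, Q (tmul g₁ g₂)⟫_ℂ = _
    rw [adjoint_pairCreation_tmul, pairCreation_tmul]
    -- Normal ordering. The scalar term is the matrix element of `1 - Ex`; the four quadratic terms
    -- produce `γ ⊗ 1` and `1 ⊗ γ`, directly and exchanged.
    have hcar : (annihilation f₁ ∘L annihilation f₂) ∘L creation g₂ ∘L creation g₁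
        = creation g₂ ∘L creation g₁ ∘L annihilation f₁ ∘L annihilation f₂
          + (⟪f₁, g₁⟫_ℂ * ⟪f₂, g₂⟫_ℂ - ⟪f₁, g₂⟫_ℂ * ⟪f₂, g₁⟫_ℂ) • ContinuousLinearMap.id ℂ (Fock H)
          - ⟪f₂, g₂⟫_ℂ • (creation g₁ ∘L annihilation f₁)
          - ⟪f₁, g₁⟫_ℂ • (creation g₂ ∘L annihilation f₂)
          + ⟪f₁, g₂⟫_ℂ • (creation g₁ ∘L annihilation f₂)
          + ⟪f₂, g₁⟫_ℂ • (creation g₂ ∘L annihilation f₁) := by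
      have car : ∀ (f g : H) (ψ : Fock H), annihilation f (creation g ψ)
          = ⟪f, g⟫_ℂ • ψ - creation g (annihilation f ψ) := fun f g ψ =>
        DFunLike.congr_fun (annihilation_comp_creation f g) ψ
      ext ψ
      simp only [comp_apply, add_apply, sub_apply, smul_apply, id_apply, car, map_sub, map_smul]
      module
    rw [hcar]
    simp only [traceWith_add h.summable, traceWith_sub h.summable, traceWith_smul h.summable, h.unit,
      ← h.one, ← h.two]
    have hone : ∀ f : H, (1 : H →L[ℂ] H) f = f := fun _ => rfl
    have hone' : ∀ F : TwoParticle H, (1 : TwoParticle H →L[ℂ] TwoParticle H) F = F := fun _ => rfl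
    simp only [hQ, add_apply, comp_apply, sub_apply, hone, hone', opTensor_tmul, map_sub,
      exchange_tmul, inner_add_right, inner_sub_right, inner_tmul_tmul]
    ring

lemma qCondition : QCondition γ Γ := by
  refine nonneg_of_inner_coe fun x => ?_
  rw [h.inner_Q]
  exact traceWith_adjoint_comp_self h.summable _

lemma γ_nonneg : 0 ≤ γ := by
  rw [nonneg_iff_isPositive, isPositive_iff_complex]
  intro f
  obtain ⟨h1, h2⟩ := h.inner_γ_self_nonneg f
  have h3 : ⟪γ f, f⟫_ℂ = ⟪f, γ f⟫_ℂ := by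
    rw [← inner_conj_symm]
    exact Complex.conj_eq_iff_im.2 h2
  rw [h3]
  exact ⟨Complex.ext (by simp) (by simp [h2]), h1⟩

lemma γ_le_one : γ ≤ 1 := by
  rw [ContinuousLinearMap.le_def, isPositive_iff_complex]
  intro f
  obtain ⟨h1, h2⟩ := h.inner_γ_self_nonneg f
  have h3 : ⟪(1 - γ) f, f⟫_ℂ = ((‖f‖ ^ 2 - (⟪f, γ f⟫_ℂ).re : ℝ) : ℂ) := by
    change ⟪f - γ f, f⟫_ℂ = _
    rw [inner_sub_left, inner_self_eq_norm_sq_to_K, ← inner_conj_symm,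
      Complex.conj_eq_iff_im.2 h2]
    refine Complex.ext ?_ ?_
    · rw [Complex.ofReal_re, Complex.sub_re, ← RCLike.ofReal_pow]
      rfl
    · rw [Complex.ofReal_im, Complex.sub_im, h2, ← RCLike.ofReal_pow, sub_zero]
      rfl
  rw [h3]
  exact ⟨rfl, sub_nonneg.2 (h.inner_γ_self_le f)⟩

variable [CompleteSpace H]

lemma isTraceClass_γ : IsTraceClass γ := by
  obtain ⟨w, e, -⟩ := exists_hilbertBasis ℂ H
  exact isTraceClass_of_nonneg h.γ_nonneg (Complex.hasSum_re (h.hasSum_γ e)).summable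

lemma isTraceClass_Γ : IsTraceClass Γ := by
  obtain ⟨w, e, -⟩ := exists_hilbertBasis ℂ H
  exact isTraceClass_of_nonneg h.pCondition (h.summable_Γ e)

lemma isAdmissible : IsAdmissible N γ Γ where
  nonneg := h.γ_nonneg
  le_one := h.γ_le_one
  trace_eq := ⟨h.isTraceClass_γ, fun _ e => h.hasSum_γ e⟩
  traceClass := h.isTraceClass_Γ
  exchange_left := by
    -- `Ex` is self-adjoint, so on the left of `Γ` it swaps the two annihilation operators.
    have hex : adjoint (exchange H) = exchange H := ext_inner_tmul_op fun f₁ f₂ g₁ g₂ => by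
      rw [adjoint_inner_right, exchange_tmul, exchange_tmul, inner_tmul_tmul, inner_tmul_tmul,
        mul_comm]
    refine ext_inner_tmul_op fun f₁ f₂ g₁ g₂ => ?_
    rw [comp_apply, ← hex, adjoint_inner_right, exchange_tmul, h.two_swap_left, neg_apply,
      inner_neg_right]
  exchange_right := h.exchange_right

end Represents

end Reduced

/-! ### The G-Condition -/

section G

variable {H : Type u} [NormedAddCommGroup H] [InnerProductSpace ℂ H] [CompleteSpace H]
variable {ι : Type*}

/-- The second quantization `∑ₖ c*(eₖ) c(B* eₖ)` of `B`, restricted to finitely many basis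
vectors. -/
noncomputable def secondQuant (e : HilbertBasis ι ℂ H) (s : Finset ι) (B : H →L[ℂ] H) :
    Fock H →L[ℂ] Fock H :=
  ∑ k ∈ s, creation (e k) * annihilation (adjoint B (e k))

variable (e : HilbertBasis ι ℂ H) (s : Finset ι) (A : H →L[ℂ] H)

/-- The ranges of the truncation `B` and of `B*` lie in the span of the `eₖ` with `k ∈ s`. Both
sides thus expand into the same finite double sum of `c*(eⱼ) c(eₖ)`. -/
lemma adjoint_secondQuant_truncate :
    adjoint (secondQuant e s (truncate e A s)) = secondQuant e s (adjoint (truncate e A s)) := by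
  set B := truncate e A s with hB
  have hB' : adjoint B = truncate e (adjoint A) s := adjoint_truncate e A s
  have h1 : ∀ k, creation (adjoint B (e k)) = ∑ j ∈ s, ⟪e j, adjoint B (e k)⟫_ℂ • creation (e j) :=
    fun k => by
      conv_lhs => rw [hB', ← sum_inner_truncate, creation_sum]
      simp only [creation_smul, hB']
  have h2 : ∀ j, annihilation (B (e j)) = ∑ k ∈ s, ⟪e j, adjoint B (e k)⟫_ℂ • annihilation (e k) :=
    fun j => by
      conv_lhs => rw [hB, ← sum_inner_truncate, annihilation_sum]
      simp only [annihilation_smul, inner_conj_symm, adjoint_inner_right, ← hB]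
  simp only [secondQuant, map_sum, adjoint_adjoint, h2, Finset.mul_sum, mul_smul_comm]
  rw [Finset.sum_comm]
  refine Finset.sum_congr rfl fun k _ => ?_
  have h3 : adjoint (creation (e k) * annihilation (adjoint B (e k)))
      = creation (adjoint B (e k)) * annihilation (e k) := by
    rw [mul_def, adjoint_comp, adjoint_annihilation]
    rfl
  rw [h3, h1, Finset.sum_mul]
  simp only [smul_mul_assoc]

/-- One use of `c c* = ⟨·,·⟩ - c* c` in the product of the two sums: the scalar part reassembles
into the second quantization of `B* B`, and the rest becomes the two-body term, its sign absorbed by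
swapping the creation operators. -/
lemma adjoint_secondQuant_comp_self :
    adjoint (secondQuant e s (truncate e A s)) ∘L secondQuant e s (truncate e A s)
      = secondQuant e s (adjoint (truncate e A s) ∘L truncate e A s)
        + ∑ k ∈ s, ∑ l ∈ s, creation (e l) ∘L creation (e k) ∘L annihilation (truncate e A s (e k))
            ∘L annihilation (adjoint (truncate e A s) (e l)) := by
  rw [adjoint_secondQuant_truncate]
  set B := truncate e A s with hB
  have h1 : ∀ k, annihilation ((adjoint B ∘L B) (e k))
      = ∑ l ∈ s, ⟪B (e k), e l⟫_ℂ • annihilation (adjoint B (e l)) := fun k => by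
    have : (adjoint B ∘L B) (e k) = ∑ l ∈ s, ⟪e l, B (e k)⟫_ℂ • adjoint B (e l) := by
      rw [comp_apply]
      conv_lhs => rw [hB, ← sum_inner_truncate, ← hB, map_sum]
      simp only [map_smul]
    rw [this, annihilation_sum]
    simp only [annihilation_smul, inner_conj_symm]
  have h2 : adjoint (adjoint B ∘L B) = adjoint B ∘L B := by rw [adjoint_comp, adjoint_adjoint]
  simp only [secondQuant, adjoint_adjoint, h2, h1]
  rw [← mul_def, Finset.sum_mul_sum]
  simp only [← mul_def, Finset.mul_sum, ← Finset.sum_add_distrib]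
  refine Finset.sum_congr rfl fun k _ => Finset.sum_congr rfl fun l _ => ?_
  have h3 : annihilation (B (e k)) * creation (e l) = ⟪B (e k), e l⟫_ℂ • 1
      - creation (e l) * annihilation (B (e k)) := annihilation_comp_creation _ _
  have h4 : creation (e k) * creation (e l) = -(creation (e l) * creation (e k)) :=
    creation_comp_creation _ _
  calc creation (e k) * annihilation (B (e k)) * (creation (e l) * annihilation (adjoint B (e l)))
      = creation (e k) * (annihilation (B (e k)) * creation (e l))
          * annihilation (adjoint B (e l)) := by simp only [mul_assoc]
    _ = ⟪B (e k), e l⟫_ℂ • (creation (e k) * annihilation (adjoint B (e l)))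
        - (creation (e k) * creation (e l)) * annihilation (B (e k))
          * annihilation (adjoint B (e l)) := by
        rw [h3, mul_sub, sub_mul, mul_smul_comm, mul_one, smul_mul_assoc]
        simp only [mul_assoc]
    _ = _ := by
        rw [h4, neg_mul, neg_mul, sub_neg_eq_add, mul_smul_comm]
        simp only [mul_assoc]

end G

/-! ### Traces in the G-Condition and removal of the truncation -/

section GCondition

variable {H : Type u} [NormedAddCommGroup H] [InnerProductSpace ℂ H] [CompleteSpace H]

/-- The value of `tr ((A* ⊗ A) (Γ + Ex (γ ⊗ 1)))`, computed in the basis `e`. -/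
noncomputable def gTrace {ι : Type*} (γ : H →L[ℂ] H) (Γ : TwoParticle H →L[ℂ] TwoParticle H)
    (e : HilbertBasis ι ℂ H) (A : H →L[ℂ] H) : ℂ :=
  traceWith (CFC.sqrt Γ) (tensorBasis e) (opTensor (adjoint A) A)
    + traceWith (CFC.sqrt γ) e (adjoint A ∘L A)

omit [CompleteSpace H] in
lemma hasTensorTrace_add {S T : TwoParticle H →L[ℂ] TwoParticle H} {z w : ℂ}
    (hS : HasTensorTrace S z) (hT : HasTensorTrace T w) : HasTensorTrace (S + T) (z + w) := by
  intro ι e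
  obtain ⟨⟨r, hr, hrz⟩, c, hc, hcz⟩ := hS ι e
  obtain ⟨⟨r', hr', hrz'⟩, c', hc', hcz'⟩ := hT ι e
  simp only [add_apply, inner_add_right]
  exact ⟨⟨_, fun k => (hr k).add (hr' k), hrz.add hrz'⟩,
    ⟨_, fun l => (hc l).add (hc' l), hcz.add hcz'⟩⟩

variable {κ : Type*} {R : Fock H →L[ℂ] Fock H} {b : HilbertBasis κ ℂ (Fock H)} {N : ℕ}
  {γ : H →L[ℂ] H} {Γ : TwoParticle H →L[ℂ] TwoParticle H}

namespace Represents

variable (h : Represents R b N γ Γ)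

include h

/-- Only the terms with `k ∈ s` survive in `tr (B γ) = ∑ₖ ⟨B* eₖ, γ eₖ⟩`, and each is an expectation
by the definition of `γ`. -/
lemma traceWith_sqrt_γ {ι : Type u} (e : HilbertBasis ι ℂ H) (s : Finset ι) (B : H →L[ℂ] H)
    (hB : ∀ k ∉ s, adjoint B (e k) = 0) :
    traceWith (CFC.sqrt γ) e B = traceWith R b (secondQuant e s B) := by
  have h1 := (hasTrace_comp h.γ_nonneg h.isTraceClass_γ e B).2 ι e
  simp only [comp_apply, ← adjoint_inner_left B] at h1
  have h2 : HasSum (fun k => ⟪adjoint B (e k), γ (e k)⟫_ℂ)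
      (∑ k ∈ s, ⟪adjoint B (e k), γ (e k)⟫_ℂ) :=
    hasSum_sum_of_ne_finset_zero fun k hk => by rw [hB k hk, inner_zero_left]
  rw [h1.unique h2, secondQuant, traceWith_sum h.summable]
  exact Finset.sum_congr rfl fun k _ => h.one _ _

/-- The adjoint of `B* ⊗ B` is `B ⊗ B*`, so the two hypotheses cut off the first and the second
index respectively. -/
lemma traceWith_sqrt_Γ {ι : Type u} (e : HilbertBasis ι ℂ H) (s : Finset ι) (B : H →L[ℂ] H)
    (hB : ∀ k ∉ s, B (e k) = 0) (hB' : ∀ k ∉ s, adjoint B (e k) = 0) :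
    traceWith (CFC.sqrt Γ) (tensorBasis e) (opTensor (adjoint B) B)
      = traceWith R b (∑ k ∈ s, ∑ l ∈ s, creation (e l) ∘L creation (e k) ∘L annihilation (B (e k))
            ∘L annihilation (adjoint B (e l))) := by
  have h1 := (hasTrace_comp h.pCondition h.isTraceClass_Γ (tensorBasis e)
    (opTensor (adjoint B) B)).2 _ (tensorBasis e)
  simp only [comp_apply, ← adjoint_inner_left (opTensor _ _), adjoint_opTensor, adjoint_adjoint,
    tensorBasis_apply, opTensor_tmul] at h1
  have h0 : ∀ f : H, tmul f 0 = 0 := fun f => by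
    rw [tmul, TensorProduct.tmul_zero, UniformSpace.Completion.coe_zero]
  have h0' : ∀ f : H, tmul 0 f = 0 := fun f => by
    rw [tmul, TensorProduct.zero_tmul, UniformSpace.Completion.coe_zero]
  have h2 : HasSum (fun p : ι × ι => ⟪tmul (B (e p.1)) (adjoint B (e p.2)),
      Γ (tmul (e p.1) (e p.2))⟫_ℂ) (∑ p ∈ s ×ˢ s, ⟪tmul (B (e p.1)) (adjoint B (e p.2)),
      Γ (tmul (e p.1) (e p.2))⟫_ℂ) :=
    hasSum_sum_of_ne_finset_zero fun p hp => by
      rw [Finset.mem_product, not_and_or] at hp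
      rcases hp with hp | hp
      · rw [hB _ hp, h0', inner_zero_left]
      · rw [hB' _ hp, h0, inner_zero_left]
  rw [h1.unique h2, Finset.sum_product, traceWith_sum h.summable]
  refine Finset.sum_congr rfl fun k _ => ?_
  rw [traceWith_sum h.summable]
  exact Finset.sum_congr rfl fun l _ => h.two _ _ _ _

/-- The G-inequality for truncated operators. -/
lemma gTrace_truncate {ι : Type u} (e : HilbertBasis ι ℂ H) (s : Finset ι) (A : H →L[ℂ] H) :
    (gTrace γ Γ e (truncate e A s)).im = 0 ∧
    ‖traceWith (CFC.sqrt γ) e (truncate e A s)‖ ^ 2 ≤ (gTrace γ Γ e (truncate e A s)).re := by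
  have hB : ∀ k ∉ s, truncate e A s (e k) = 0 := fun k hk => truncate_basis_of_notMem e A hk
  have hB' : ∀ k ∉ s, adjoint (truncate e A s) (e k) = 0 := fun k hk => by
    rw [adjoint_truncate]
    exact truncate_basis_of_notMem e _ hk
  have hg : gTrace γ Γ e (truncate e A s) = traceWith R b
      (adjoint (secondQuant e s (truncate e A s)) ∘L secondQuant e s (truncate e A s)) := by
    rw [gTrace, h.traceWith_sqrt_Γ e s _ hB hB', h.traceWith_sqrt_γ e s _ fun k hk => by
        rw [adjoint_comp, adjoint_adjoint, comp_apply, hB k hk, map_zero],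
      adjoint_secondQuant_comp_self, traceWith_add h.summable, add_comm]
  rw [hg, h.traceWith_sqrt_γ e s _ hB']
  exact ⟨(traceWith_adjoint_comp_self h.summable _).2, norm_traceWith_sq_le h.summable h.unit _⟩

/-- The truncations and their adjoints converge strongly with norms at most `‖A‖`. Since `√γ` and
`√Γ` are Hilbert–Schmidt, all traces involved converge by dominated convergence, and the inequality
survives the limit. -/
lemma gTrace_inequality {ι : Type u} (e : HilbertBasis ι ℂ H) (A : H →L[ℂ] H) :
    (gTrace γ Γ e A).im = 0 ∧
    ‖traceWith (CFC.sqrt γ) e A‖ ^ 2 ≤ (gTrace γ Γ e A).re := by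
  have hγ := h.isTraceClass_γ.summable h.γ_nonneg e
  have hΓ := h.isTraceClass_Γ.summable h.pCondition (tensorBasis e)
  have hA := norm_truncate_le e A
  have hA' : ∀ s, ‖adjoint (truncate e A s)‖ ≤ ‖A‖ := fun s => by
    rw [LinearIsometryEquiv.norm_map]
    exact hA s
  have ht := tendsto_truncate e A
  have ht' : ∀ x, Tendsto (fun s => adjoint (truncate e A s) x) atTop (𝓝 (adjoint A x)) :=
    fun x => by
      simp only [adjoint_truncate]
      exact tendsto_truncate e (adjoint A) x
  have l1 : Tendsto (fun s => traceWith (CFC.sqrt γ) e (truncate e A s)) atTop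
      (𝓝 (traceWith (CFC.sqrt γ) e A)) := tendsto_traceWith hγ hA ht
  have l2 : Tendsto (fun s => gTrace γ Γ e (truncate e A s)) atTop (𝓝 (gTrace γ Γ e A)) := by
    refine (tendsto_traceWith hΓ (C := ‖A‖ * ‖A‖) (fun s => (norm_opTensor_le _ _).trans ?_)
      (tendsto_opTensor hA' hA ht' ht)).add
      (tendsto_traceWith hγ (C := ‖A‖ * ‖A‖) (fun s => (opNorm_comp_le _ _).trans ?_)
      (tendsto_comp hA' ht' ht))
    all_goals exact mul_le_mul (hA' s) (hA s) (norm_nonneg _) (norm_nonneg _)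
  constructor
  · exact tendsto_nhds_unique ((Complex.continuous_im.tendsto _).comp l2)
      (by simp [Function.comp_def, (h.gTrace_truncate e _ A).1])
  · exact le_of_tendsto_of_tendsto' (l1.norm.pow 2) ((Complex.continuous_re.tendsto _).comp l2)
      fun s => (h.gTrace_truncate e s A).2

/-- The iterated series for `tr ((A* ⊗ A) Ex (γ ⊗ 1))` converge to `tr (A* A γ)`. -/
lemma hasTensorTrace_exchange {ι : Type u} (e₀ : HilbertBasis ι ℂ H) (A : H →L[ℂ] H) :
    HasTensorTrace (opTensor (adjoint A) A ∘L exchange H ∘L opTensor γ 1)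
      (traceWith (CFC.sqrt γ) e₀ (adjoint A ∘L A)) := by
  intro μ e
  have hentry : ∀ k l, ⟪tmul (e k) (e l),
      (opTensor (adjoint A) A ∘L exchange H ∘L opTensor γ 1) (tmul (e k) (e l))⟫_ℂ
      = ⟪e k, adjoint A (e l)⟫_ℂ * ⟪e l, A (γ (e k))⟫_ℂ := fun k l => by
    rw [comp_apply, comp_apply, opTensor_tmul, exchange_tmul, opTensor_tmul, inner_tmul_tmul]
    rfl
  have hsa : adjoint γ = γ := ((nonneg_iff_isPositive _).1 h.γ_nonneg).isSelfAdjoint.adjoint_eq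
  have hγ := h.isTraceClass_γ.summable h.γ_nonneg e₀
  simp only [hentry]
  constructor
  -- Summing over `l` first, Parseval leaves the diagonal terms of `tr (A* A γ)`.
  · refine ⟨fun k => ⟪A (e k), A (γ (e k))⟫_ℂ, fun k => ?_, ?_⟩
    · simp only [adjoint_inner_right]
      exact e.hasSum_inner_mul_inner _ _
    · have := (hasTrace_comp h.γ_nonneg h.isTraceClass_γ e₀ (adjoint A ∘L A)).2 μ e
      simpa only [comp_apply, adjoint_inner_right] using this
  -- Summing over `k` first leaves `‖√γ A* eₗ‖²`. These add up to the squared Hilbert–Schmidt norm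
  -- of `√γ A*`, which is that of its adjoint `A √γ`, namely `tr (A* A γ)`.
  · refine ⟨fun l => ⟪adjoint A (e l), γ (adjoint A (e l))⟫_ℂ, fun l => ?_, ?_⟩
    · have h1 := e.hasSum_inner_mul_inner (γ (adjoint A (e l))) (adjoint A (e l))
      rw [← adjoint_inner_right, hsa] at h1
      refine (congrArg (HasSum · _) (funext fun k => ?_)).mp h1
      rw [← adjoint_inner_left A, ← adjoint_inner_left γ, hsa, mul_comm]
    · have h1 := hasSum_norm_sq_traceWith hγ A
      have h2 := hasSum_norm_sq_adjoint e₀ e (K := A ∘L CFC.sqrt γ) h1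
      have h3 := Complex.hasSum_ofReal.2 h2
      have him := (traceWith_adjoint_comp_self hγ A).2
      have h4 : (((traceWith (CFC.sqrt γ) e₀ (adjoint A ∘L A)).re : ℝ) : ℂ)
          = traceWith (CFC.sqrt γ) e₀ (adjoint A ∘L A) := Complex.ext (by simp) (by simp [him])
      rw [h4] at h3
      refine (congrArg (HasSum · _) (funext fun l => ?_)).mp h3
      rw [adjoint_comp, adjoint_sqrt, comp_apply, norm_sqrt_sq h.γ_nonneg]
      exact Complex.ext (by simp) (by simp [(h.inner_γ_self_nonneg _).2])

/-- The trace of `B Γ` is also the sum of the double series, in either order. -/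
lemma hasTensorTrace_Γ {ι : Type u} (e₀ : HilbertBasis ι ℂ H)
    (B : TwoParticle H →L[ℂ] TwoParticle H) :
    HasTensorTrace (B ∘L Γ) (traceWith (CFC.sqrt Γ) (tensorBasis e₀) B) := by
  intro μ e
  have h1 := (hasTrace_comp h.pCondition h.isTraceClass_Γ (tensorBasis e₀) B).2 _ (tensorBasis e)
  simp only [tensorBasis_apply] at h1
  have h2 := (Equiv.prodComm μ μ).hasSum_iff.2 h1
  exact ⟨⟨_, fun k => (h1.summable.prod_factor k).hasSum,
      h1.prod_fiberwise fun k => (h1.summable.prod_factor k).hasSum⟩,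
    ⟨_, fun l => (h2.summable.prod_factor l).hasSum,
      h2.prod_fiberwise fun l => (h2.summable.prod_factor l).hasSum⟩⟩

lemma gCondition : GCondition γ Γ := by
  intro A
  -- This basis only names the two values; the trace statements below hold in every basis, so the
  -- values do not depend on it.
  obtain ⟨w, e, -⟩ := exists_hilbertBasis ℂ H
  obtain ⟨h1, h2⟩ := h.gTrace_inequality e A
  refine ⟨gTrace γ Γ e A, traceWith (CFC.sqrt γ) e A, ?_,
    hasTrace_comp h.γ_nonneg h.isTraceClass_γ e A, h1, h2⟩
  rw [comp_add]
  exact hasTensorTrace_add (h.hasTensorTrace_Γ e _) (h.hasTensorTrace_exchange e A)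

end Represents

end GCondition

end FermionFock

theorem corollary3p3 {H : Type u} [NormedAddCommGroup H] [InnerProductSpace ℂ H] [CompleteSpace H]
    [TopologicalSpace.SeparableSpace H] (N : ℕ) (γ : H →L[ℂ] H)
    (Γ : FermionFock.TwoParticle H →L[ℂ] FermionFock.TwoParticle H)
    (h : FermionFock.IsNRepresentable N γ Γ) :
    FermionFock.IsAdmissible N γ Γ ∧ FermionFock.GCondition γ Γ ∧ FermionFock.PCondition Γ ∧
      FermionFock.QCondition γ Γ := by
  obtain ⟨κ, R, b, hR⟩ := h.exists_represents
  exact ⟨hR.isAdmissible, hR.gCondition, hR.pCondition, hR.qCondition⟩
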